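/- Let $\mathbb N=\{1,2,\dots\}$, $\mathbb N_0=\mathbb N\cup\{0\}$, let $N,L\in\mathbb N$ and $m_1,\dots,m_N\in\mathbb N$. Let $$D=\Big\{p=((p_{i,\nu})_{i=1}^{m_\nu})_{\nu=1}^N : p_{i,\nu}>0,\ \sum_{i=1}^{m_\nu}p_{i,\nu}<1 \text{ for all } \nu\Big\},\qquad p_{0,\nu}=1-\sum_{i=1}^{m_\nu}p_{i,\nu}.$$ **Data.** For $r_1,\dots,r_N>0$ and $p\in D$ let $X=(X_1,\dots,X_N)$ have independent negative multinomial components, $X_\nu$ having mass function $$\frac{\Gamma(r_\nu+\sum_i x_{i,\nu})}{\Gamma(r_\nu)\prod_i x_{i,\nu}!}\,p_{0,\nu}^{r_\nu}\prod_{i=1}^{m_\nu}p_{i,\nu}^{x_{i,\nu}},\qquad x_\nu\in\mathbb N_0^{m_\nu}.$$ **Tables to be predicted.** For $\lambda=1,\dots,L$ let $l^{(\lambda)}\in\mathbb N$, $d^{(\lambda)}\in\{1,\dots,N\}$ and $1\le\nu^{(\lambda)}_1<\dots<\nu^{(\lambda)}_{d^{(\lambda)}}\le N$, and let $I_0^{(\lambda)}=\prod_{h=1}^{d^{(\lambda)}}\{0,1,\dots,m_{\nu_h^{(\lambda)}}\}$.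 Independently of $X$, let $W^{(1)},\dots,W^{(L)}$ be independent multinomial tables, $W^{(\lambda)}$ having total $l^{(\lambda)}$ and probability $\prod_{h}p_{i_h,\nu_h^{(\lambda)}}$ for the cell $i=(i_h)_h\in I_0^{(\lambda)}$; so $W=(W^{(\lambda)})_\lambda$ has mass function $$f(w\mid p)=\prod_{\lambda=1}^L \frac{l^{(\lambda)}!}{\prod_{i\in I_0^{(\lambda)}}w_i^{(\lambda)}!}\prod_{i\in I_0^{(\lambda)}}\Big(\prod_{h=1}^{d^{(\lambda)}}p_{i_h,\nu_h^{(\lambda)}}\Big)^{w_i^{(\lambda)}},\qquad w_i^{(\lambda)}\in\mathbb N_0,\ \sum_{i\in I_0^{(\lambda)}} w^{(\lambda)}_i=l^{(\lambda)}.$$ **Predictive masses.** The risk at $p\in D$ of a predictive mass $\hat f(\cdot\,;X)$ is $R(\hat f,p)=E_p\big[\log\{f(W\mid p)/\hat f(W;X)\}\big]$. We say that $\hat f$ dominates $\hat g$ if both have finite risk at every $p\in D$, $R(\hat f,p)\le R(\hat g,p)$ for all $p\in D$, and $R(\hat f,p)<R(\hat g,p)$ for some $p\in D$. For a (possibly improper)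 prior density $\pi$ on $D$, the Bayesian predictive mass is the posterior mean $\hat f^{(\pi)}(w;X)=E_\pi[f(w\mid p)\mid X]$. Let $a_{0,\nu}\in\mathbb R$, $a_{i,\nu}>0$ $(1\le i\le m_\nu)$, $a_{\cdot,\nu}=\sum_{i=1}^{m_\nu}a_{i,\nu}$, $\alpha,\beta>0$, $\gamma_\nu>0$ for $\nu=1,\dots,N$, and consider the priors $$\pi_{\mathrm{Dir}}(p)\propto\prod_{\nu=1}^N\Big(p_{0,\nu}^{a_{0,\nu}-1}\prod_{i=1}^{m_\nu}p_{i,\nu}^{a_{i,\nu}-1}\Big),\qquad \pi_{\mathrm{sh}}(p)=\int_0^\infty u^{\alpha-1}e^{-\beta u}\prod_{\nu=1}^N\Big(p_{0,\nu}^{\gamma_\nu u+a_{0,\nu}-1}\prod_{i=1}^{m_\nu}p_{i,\nu}^{a_{i,\nu}-1}\Big)du.$$ **Theorem.** Assume that $r_\nu\ge1$ and $r_\nu+a_{0,\nu}>0$ for all $\nu=1,\dots,N$, and that, with $\Lambda(\nu)=\{\lambda : \nu\in\{\nu_1^{(\lambda)},\dots,\nu_{d^{(\lambda)}}^{(\lambda)}\}\}$,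 $$\Big\{\frac{(\alpha+1)\gamma_\nu}{\beta+\gamma_\nu}-a_{\cdot,\nu}\Big\}(r_\nu-1)\le x_\nu\Big\{-\frac{(\alpha+1)\gamma_\nu}{\beta+\gamma_\nu}-\sum_{\lambda\in\Lambda(\nu)}l^{(\lambda)}-a_{0,\nu}\Big\}$$ for all $x_\nu\in\mathbb N$ and all $\nu=1,\dots,N$. Then $\hat f^{(\pi_{\mathrm{sh}})}(\cdot\,;X)$ dominates $\hat f^{(\pi_{\mathrm{Dir}})}(\cdot\,;X)$. -/

import Mathlib

open scoped Nat BigOperators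

noncomputable section

namespace MultinomialPrediction

/-- Families `p = (p_ν)`, `p_ν ∈ ℝ^{m_ν}`; `p ν i` (`i : Fin (m ν)`) is the entry
`p_{i+1, ν}`. -/
abbrev Param {N : ℕ} (m : Fin N → ℕ) : Type := ∀ ν : Fin N, Fin (m ν) → ℝ

/-- Observations `x = (x_ν)`, `x_ν ∈ ℕ₀^{m_ν}`. -/
abbrev Obs {N : ℕ} (m : Fin N → ℕ) : Type := ∀ ν : Fin N, Fin (m ν) → ℕ

/-- The parameter space `D = D_{m_1} × ⋯ × D_{m_N}`, a product of open simplices. -/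
def paramSpace {N : ℕ} (m : Fin N → ℕ) : Set (Param m) :=
  {p | ∀ ν, (∀ i, 0 < p ν i) ∧ ∑ i, p ν i < 1}

/-- `p_{0, ν} = 1 - ∑ i, p_{i, ν}`. -/
def p₀ {N : ℕ} {m : Fin N → ℕ} (p : Param m) (ν : Fin N) : ℝ := 1 - ∑ i, p ν i

/-- The full probability vector `(p_{0, ν}, p_{1, ν}, …, p_{m_ν, ν})`. -/
def fullProb {N : ℕ} {m : Fin N → ℕ} (p : Param m) (ν : Fin N) : Fin (m ν + 1) → ℝ :=
  Fin.cons (p₀ p ν) (p ν)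

/-- Joint mass function of independent negative multinomial vectors `X_1, …, X_N`. -/
def negMultinomialMass {N : ℕ} {m : Fin N → ℕ} (r : Fin N → ℝ) (p : Param m) (x : Obs m) : ℝ :=
  ∏ ν, (Real.Gamma (r ν + ∑ i, (x ν i : ℝ)) / (Real.Gamma (r ν) * ∏ i, ((x ν i)! : ℝ)) *
    p₀ p ν ^ r ν * ∏ i, p ν i ^ x ν i)

/-- Cell indices of table `t`: the product of the sets `{0, 1, …, m_ν}` over the indices
`ν = nu t 0, nu t 1, …` that the table involves. -/
abbrev Cell {N L : ℕ} (m : Fin N → ℕ) {d : Fin L → ℕ} (nu : ∀ t : Fin L, Fin (d t) → Fin N)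
    (t : Fin L) : Type :=
  ∀ h : Fin (d t), Fin (m (nu t h) + 1)

/-- Families of tables of counts; the `t`-th table has total `l t`. -/
abbrev Tables {N L : ℕ} (m : Fin N → ℕ) {d : Fin L → ℕ} (nu : ∀ t : Fin L, Fin (d t) → Fin N)
    (l : Fin L → ℕ) : Type :=
  ∀ t : Fin L, {w : Cell m nu t → ℕ // ∑ i, w i = l t}

/-- Joint mass function `f(w | p)` of the independent multinomial tables. -/
def tableMass {N L : ℕ} {m : Fin N → ℕ} {d : Fin L → ℕ} {nu : ∀ t : Fin L, Fin (d t) → Fin N}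
    {l : Fin L → ℕ} (p : Param m) (w : Tables m nu l) : ℝ :=
  ∏ t, (((l t)! : ℝ) / (∏ i, (((w t).1 i)! : ℝ)) *
    ∏ i : Cell m nu t, (∏ h, fullProb p (nu t h) (i h)) ^ (w t).1 i)

/-- Bayesian predictive mass `E_π[f(w | p) | X = x]` for a (possibly improper) prior density `π` on
the parameter space with respect to Lebesgue measure. It does not depend on the scale of `π`. -/
def bayesPredictive {N L : ℕ} {m : Fin N → ℕ} {d : Fin L → ℕ}
    {nu : ∀ t : Fin L, Fin (d t) → Fin N} {l : Fin L → ℕ} (r : Fin N → ℝ) (π : Param m → ℝ)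
    (w : Tables m nu l) (x : Obs m) : ℝ :=
  (∫ p in paramSpace m, tableMass p w * (negMultinomialMass r p x * π p)) /
    ∫ p in paramSpace m, negMultinomialMass r p x * π p

/-- The (unnormalized) Dirichlet prior density. -/
def dirichletPrior {N : ℕ} {m : Fin N → ℕ} (a₀ : Fin N → ℝ) (a : ∀ ν : Fin N, Fin (m ν) → ℝ)
    (p : Param m) : ℝ :=
  ∏ ν, (p₀ p ν ^ (a₀ ν - 1) * ∏ i, p ν i ^ (a ν i - 1))

/-- The (unnormalized) hierarchical shrinkage prior density, a gamma mixture. -/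
def shrinkagePrior {N : ℕ} {m : Fin N → ℕ} (α β : ℝ) (γ : Fin N → ℝ) (a₀ : Fin N → ℝ)
    (a : ∀ ν : Fin N, Fin (m ν) → ℝ) (p : Param m) : ℝ :=
  ∫ u in Set.Ioi (0 : ℝ), u ^ (α - 1) * Real.exp (-β * u) *
    ∏ ν, (p₀ p ν ^ (γ ν * u + a₀ ν - 1) * ∏ i, p ν i ^ (a ν i - 1))

/-- The terms of the series which expresses `E[log (f(W | p) / f̂(W; X))]` through the joint mass
function of the independent pair `(X, W)`. -/
def riskTerm {N L : ℕ} {m : Fin N → ℕ} {d : Fin L → ℕ} {nu : ∀ t : Fin L, Fin (d t) → Fin N}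
    {l : Fin L → ℕ} (r : Fin N → ℝ) (fhat : Tables m nu l → Obs m → ℝ) (p : Param m)
    (z : Obs m × Tables m nu l) : ℝ :=
  negMultinomialMass r p z.1 * tableMass p z.2 *
    Real.log (tableMass p z.2 / fhat z.2 z.1)

/-- The expectation `E[log (f(W | p) / f̂(W; X))]` exists and is finite at `p`. -/
def RiskFinite {N L : ℕ} {m : Fin N → ℕ} {d : Fin L → ℕ} {nu : ∀ t : Fin L, Fin (d t) → Fin N}
    {l : Fin L → ℕ} (r : Fin N → ℝ) (fhat : Tables m nu l → Obs m → ℝ) (p : Param m) : Prop :=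
  Summable (riskTerm r fhat p)

/-- Kullback–Leibler risk `E[log (f(W | p) / f̂(W; X))]` of a predictive mass at `p`. -/
def risk {N L : ℕ} {m : Fin N → ℕ} {d : Fin L → ℕ} {nu : ∀ t : Fin L, Fin (d t) → Fin N}
    {l : Fin L → ℕ} (r : Fin N → ℝ) (fhat : Tables m nu l → Obs m → ℝ) (p : Param m) : ℝ :=
  ∑' z, riskTerm r fhat p z

/-- `fhat` dominates `ghat`: both risk functions are finite on the parameter space, that of `fhat`
is nowhere larger than that of `ghat`, and it is smaller somewhere. -/
def Dominates {N L : ℕ} {m : Fin N → ℕ} {d : Fin L → ℕ} {nu : ∀ t : Fin L, Fin (d t) → Fin N}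
    {l : Fin L → ℕ} (r : Fin N → ℝ) (fhat ghat : Tables m nu l → Obs m → ℝ) : Prop :=
  (∀ p ∈ paramSpace m, RiskFinite r fhat p ∧ RiskFinite r ghat p) ∧
  (∀ p ∈ paramSpace m, risk r fhat p ≤ risk r ghat p) ∧
  ∃ p ∈ paramSpace m, risk r fhat p < risk r ghat p

open Classical in
/-- `∑_{t ∈ Λ(ν)} l t`, where `Λ(ν)` is the set of the tables that involve `p_ν`. -/
def totalCount {N L : ℕ} {d : Fin L → ℕ} (nu : ∀ t : Fin L, Fin (d t) → Fin N) (l : Fin L → ℕ)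
    (ν : Fin N) : ℕ :=
  ∑ t ∈ Finset.univ.filter (fun t => ∃ h, nu t h = ν), l t

end MultinomialPrediction

end

/-! By conjugacy, integrating out `p` leaves a product of Gamma functions under the Dirichlet prior.
Under the shrinkage prior the `u`-dependent part of that product becomes `gammaTilt`, averaged
against a gamma density in `u`. The other factors cancel, so the log ratio of the predictive masses
is `ℓ(c, T, Y) - ℓ(0, 0, Y)` with `ℓ` = `logTiltRatio`, `c` the category-0 counts in the tables, `T`
= `totalCount` and `Y` = `obsTotal`. The Dirichlet risk minus the shrinkage risk is the mean of this
quantity, and it has to be positive.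

Cell probabilities are products, so the `c_ν` are independent binomials with parameters `(T_ν,
p₀_ν)` (`sum_tableMass_mul_prod_X`). The tables may thus be replaced by `T_ν` successive draws from
each vector, and it suffices that every single draw raises the mean
(`lt_monomialFunctional_prod_drawPoly`).

Let `e` be the `ν`-th unit vector, `g(y) = ℓ(c+e, n+e, y) - ℓ(c, n+e, y)` and `h(y) = ℓ(c, n, y) -
ℓ(c, n+e, y)`. One draw raises the mean iff `E h(Y) < p₀ E g(Y)`. The shift identity
`tsum_negMultinomialMass_shift` eliminates `p`: `(1 - p₀) E g(Y) = E[t g(Y - e)]` with `t = Y_ν /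
(r_ν + Y_ν - 1)`. So the pointwise inequality `h(y) + t g(y - e) ≤ g(y)`, strict when `y_ν = 0`, is
enough. For `y_ν ≥ 1` the condition `r_ν ≥ 1` puts `t` in `[0, 1]`, and Bernoulli's inequality
reduces the claim to a bound on the ratio of the second to the first moment of the tilted density
(`tiltMoment_ratio_le`). That bound combines an integration by parts, the estimate `ψ(z + v) - ψ(z)
≥ v / (z + v)` for the digamma function, and Cauchy–Schwarz; the assumption of the theorem supplies
its hypothesis through `gain_condition`.

Convergence of all series follows because the logarithms involved grow at most linearly in `Y`,
which has a finite mean. -/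

open MeasureTheory Set Filter Topology

namespace MultinomialPrediction

section

/-! ### The real digamma function -/

/-- The logarithmic derivative of the Gamma function on the positive half-line. -/
noncomputable def digamma (z : ℝ) : ℝ := deriv (fun t => Real.log (Real.Gamma t)) z

theorem differentiableAt_Gamma_of_pos {z : ℝ} (hz : 0 < z) : DifferentiableAt ℝ Real.Gamma z :=
  Real.differentiableAt_Gamma fun m h => by
    have : (0 : ℝ) ≤ m := m.cast_nonneg
    linarith

theorem hasDerivAt_log_Gamma {z : ℝ} (hz : 0 < z) :
    HasDerivAt (fun t => Real.log (Real.Gamma t)) (digamma z) z :=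
  ((differentiableAt_Gamma_of_pos hz).log (Real.Gamma_pos_of_pos hz).ne').hasDerivAt

theorem digamma_monotoneOn : MonotoneOn digamma (Ioi 0) :=
  Real.convexOn_log_Gamma.monotoneOn_deriv fun _ hx => (hasDerivAt_log_Gamma hx).differentiableAt

theorem log_Gamma_add_one {z : ℝ} (hz : 0 < z) :
    Real.log (Real.Gamma (z + 1)) = Real.log z + Real.log (Real.Gamma z) := by
  rw [Real.Gamma_add_one hz.ne', Real.log_mul hz.ne' (Real.Gamma_pos_of_pos hz).ne']

theorem digamma_add_one {z : ℝ} (hz : 0 < z) : digamma (z + 1) = digamma z + 1 / z := by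
  have h1 : HasDerivAt (fun t => Real.log (Real.Gamma (t + 1))) (digamma (z + 1)) z := by
    have := (hasDerivAt_log_Gamma (by linarith : 0 < z + 1)).comp z ((hasDerivAt_id z).add_const 1)
    simpa [Function.comp_def] using this
  have h2 : HasDerivAt (fun t => Real.log t + Real.log (Real.Gamma t)) (z⁻¹ + digamma z) z :=
    (Real.hasDerivAt_log hz.ne').add (hasDerivAt_log_Gamma hz)
  have h3 := h2.congr_of_eventuallyEq
    (f₁ := fun t => Real.log (Real.Gamma (t + 1))) (by
      filter_upwards [lt_mem_nhds hz] with t ht using log_Gamma_add_one ht)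
  rw [h1.unique h3, one_div, add_comm]

/-- By the recurrence, the defect `D` does not decrease when its argument grows by one; by
monotonicity of `digamma` it is at most `v / (z + n)` at `z + n`. Letting `n` grow gives `D z ≤ 0`.
-/
theorem div_add_le_digamma_add_sub {z v : ℝ} (hz : 0 < z) (hv : 0 ≤ v) :
    v / (z + v) ≤ digamma (z + v) - digamma z := by
  set D : ℝ → ℝ := fun z => digamma z + v / (z + v) - digamma (z + v) with hD
  have step : ∀ t, 0 < t → D t ≤ D (t + 1) := by
    intro t ht
    have h1 := digamma_add_one ht
    have h2 := digamma_add_one (by linarith : 0 < t + v)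
    have e : t + 1 + v = t + v + 1 := by ring
    have key : 0 ≤ 1 / t - 1 / (t + v) + v / (t + v + 1) - v / (t + v) := by
      have : 1 / t - 1 / (t + v) + v / (t + v + 1) - v / (t + v)
          = v * (v + 1) / (t * (t + v) * (t + v + 1)) := by
        have : 0 < t + v := by linarith
        field_simp
        ring
      rw [this]
      have : 0 < t + v := by linarith
      positivity
    simp only [hD, e, h1, h2]
    linarith
  have mono : ∀ n : ℕ, D z ≤ D (z + n) := by
    intro n
    induction n with
    | zero => simp
    | succ n ih =>
      have hn : (0 : ℝ) ≤ n := n.cast_nonneg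
      refine ih.trans ((step _ (by linarith)).trans_eq ?_)
      push_cast
      rw [add_assoc]
  have up : ∀ n : ℕ, D z ≤ v / (z + n) := by
    intro n
    have hn : (0 : ℝ) ≤ n := n.cast_nonneg
    refine (mono n).trans ?_
    have h1 : digamma (z + n) ≤ digamma (z + n + v) :=
      digamma_monotoneOn (by simp only [mem_Ioi]; linarith) (by simp only [mem_Ioi]; linarith)
        (by linarith)
    have h2 : v / (z + n + v) ≤ v / (z + n) :=
      div_le_div_of_nonneg_left hv (by linarith) (by linarith)
    simp only [hD]
    linarith
  have lim : Tendsto (fun n : ℕ => v / (z + n)) atTop (𝓝 0) :=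
    Tendsto.const_div_atTop (tendsto_atTop_add_const_left _ _ tendsto_natCast_atTop_atTop) _
  have := ge_of_tendsto' lim up
  simp only [hD] at this
  linarith

/-- Convexity of `log Γ`: the slope over `[z, z + g]` is at most the slope over the next unit
interval, which is `log (z + g)`. -/
theorem log_Gamma_add_sub_le {z g : ℝ} (hz : 0 < z) (hg : 0 < g) :
    Real.log (Real.Gamma (z + g)) - Real.log (Real.Gamma z) ≤ g * Real.log (z + g) := by
  have h := Real.convexOn_log_Gamma.slope_mono_adjacent (x := z) (y := z + g) (z := z + g + 1)
    hz (by simp only [mem_Ioi]; linarith) (by linarith) (by linarith)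
  simp only [Function.comp_apply, log_Gamma_add_one (by linarith : 0 < z + g)] at h
  rw [add_sub_cancel_left, add_sub_cancel_left, div_one, div_le_iff₀ hg] at h
  linarith

theorem digamma_gap_nonneg {γ s τ u : ℝ} (hγ : 0 < γ) (hs : 0 < s) (hτ : s ≤ τ) (hu : 0 ≤ u) :
    0 ≤ γ * (digamma (τ + γ * u) - digamma (s + γ * u)) := by
  have h3 : 0 ≤ γ * u := mul_nonneg hγ.le hu
  exact mul_nonneg hγ.le (sub_nonneg.2 (digamma_monotoneOn (mem_Ioi.2 (by linarith))
    (mem_Ioi.2 (by linarith)) (by linarith)))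

/-! ### Products of ratios of Gamma functions -/

variable {ι : Type*} [Fintype ι]

/-- The product of the ratios `Γ(s i + γ i u) / Γ(τ i + γ i u)`. -/
noncomputable def gammaTilt (γ s τ : ι → ℝ) (u : ℝ) : ℝ :=
  ∏ i, Real.Gamma (s i + γ i * u) / Real.Gamma (τ i + γ i * u)

variable {γ s τ : ι → ℝ}

theorem gammaTilt_pos (hγ : ∀ i, 0 < γ i) (hs : ∀ i, 0 < s i) (hτ : ∀ i, s i ≤ τ i) {u : ℝ}
    (hu : 0 ≤ u) : 0 < gammaTilt γ s τ u :=
  Finset.prod_pos fun i _ => by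
    have h1 := hs i
    have h2 := hτ i
    have h3 : 0 ≤ γ i * u := mul_nonneg (hγ i).le hu
    exact div_pos (Real.Gamma_pos_of_pos (by linarith)) (Real.Gamma_pos_of_pos (by linarith))

/-- Logarithmic differentiation. The derivative is two-sided even at `u = 0`, because the Gamma
arguments stay positive on a neighbourhood. -/
theorem hasDerivAt_gammaTilt (hγ : ∀ i, 0 < γ i) (hs : ∀ i, 0 < s i) (hτ : ∀ i, s i ≤ τ i) {u : ℝ}
    (hu : 0 ≤ u) :
    HasDerivAt (gammaTilt γ s τ)
      (-(∑ i, γ i * (digamma (τ i + γ i * u) - digamma (s i + γ i * u))) * gammaTilt γ s τ u) u := by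
  have hlog : HasDerivAt (fun u => ∑ i, (Real.log (Real.Gamma (s i + γ i * u)) -
      Real.log (Real.Gamma (τ i + γ i * u))))
      (∑ i, (digamma (s i + γ i * u) * γ i - digamma (τ i + γ i * u) * γ i)) u := by
    refine HasDerivAt.fun_sum fun i _ => ?_
    have h1 := hs i
    have h2 := hτ i
    have h3 : 0 ≤ γ i * u := mul_nonneg (hγ i).le hu
    have lin : ∀ c : ℝ, HasDerivAt (fun u => c + γ i * u) (γ i) u := fun c => by
      simpa using ((hasDerivAt_id u).const_mul (γ i)).const_add c
    exact ((hasDerivAt_log_Gamma (by linarith)).comp u (lin (s i))).sub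
      ((hasDerivAt_log_Gamma (by linarith)).comp u (lin (τ i)))
  have hexp := hlog.exp
  have hev : ∀ᶠ t in 𝓝 u, gammaTilt γ s τ t = Real.exp (∑ i, (Real.log (Real.Gamma (s i + γ i * t)) -
      Real.log (Real.Gamma (τ i + γ i * t)))) := by
    have hpos : ∀ᶠ t in 𝓝 u, ∀ i, 0 < s i + γ i * t := by
      refine eventually_all.2 fun i => ?_
      have hc : ContinuousAt (fun t => s i + γ i * t) u := by fun_prop
      refine hc.eventually (lt_mem_nhds ?_)
      have h3 : 0 ≤ γ i * u := mul_nonneg (hγ i).le hu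
      have := hs i
      linarith
    filter_upwards [hpos] with t ht
    rw [Real.exp_sum]
    refine Finset.prod_congr rfl fun i _ => ?_
    have h2 := hτ i
    have h4 := ht i
    rw [Real.exp_sub, Real.exp_log (Real.Gamma_pos_of_pos h4),
      Real.exp_log (Real.Gamma_pos_of_pos (by linarith))]
  have := hexp.congr_of_eventuallyEq hev
  rw [← hev.self_of_nhds] at this
  rwa [show -(∑ i, γ i * (digamma (τ i + γ i * u) - digamma (s i + γ i * u))) * gammaTilt γ s τ u =
    gammaTilt γ s τ u * ∑ i, (digamma (s i + γ i * u) * γ i - digamma (τ i + γ i * u) * γ i) by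
      rw [mul_comm, ← Finset.sum_neg_distrib]
      congr 1
      exact Finset.sum_congr rfl fun i _ => by ring]

theorem gammaTilt_continuousOn (hγ : ∀ i, 0 < γ i) (hs : ∀ i, 0 < s i) (hτ : ∀ i, s i ≤ τ i) :
    ContinuousOn (gammaTilt γ s τ) (Ici 0) := fun _ hu =>
  (hasDerivAt_gammaTilt hγ hs hτ hu).continuousAt.continuousWithinAt

theorem gammaTilt_antitoneOn (hγ : ∀ i, 0 < γ i) (hs : ∀ i, 0 < s i) (hτ : ∀ i, s i ≤ τ i) :
    AntitoneOn (gammaTilt γ s τ) (Ici 0) := by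
  refine antitoneOn_of_deriv_nonpos (convex_Ici 0) (gammaTilt_continuousOn hγ hs hτ)
    (fun u hu => ?_) (fun u hu => ?_)
  · rw [interior_Ici] at hu
    exact (hasDerivAt_gammaTilt hγ hs hτ (le_of_lt hu)).differentiableAt.differentiableWithinAt
  · rw [interior_Ici] at hu
    have hu' : 0 ≤ u := le_of_lt hu
    rw [(hasDerivAt_gammaTilt hγ hs hτ hu').deriv, neg_mul]
    exact neg_nonpos.2 (mul_nonneg (Finset.sum_nonneg fun i _ => digamma_gap_nonneg (hγ i) (hs i) (hτ i) hu')
      (gammaTilt_pos hγ hs hτ hu').le)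

theorem gammaTilt_eq_mul_prod_erase [DecidableEq ι] (γ s τ : ι → ℝ) (u : ℝ) (j : ι) :
    gammaTilt γ s τ u = Real.Gamma (s j + γ j * u) / Real.Gamma (τ j + γ j * u) *
      ∏ i ∈ Finset.univ.erase j, Real.Gamma (s i + γ i * u) / Real.Gamma (τ i + γ i * u) :=
  (Finset.mul_prod_erase _ (fun i => Real.Gamma (s i + γ i * u) / Real.Gamma (τ i + γ i * u))
    (Finset.mem_univ j)).symm

/-- Through `Γ(z + 1) = z Γ(z)`, a unit shift of a parameter costs a factor linear in `u`; at the
level of moments it therefore mixes two consecutive orders. -/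
theorem gammaTilt_add_single_left [DecidableEq ι] (hγ : ∀ i, 0 < γ i) (hs : ∀ i, 0 < s i) {u : ℝ}
    (hu : 0 ≤ u) (j : ι) :
    gammaTilt γ (s + Pi.single j 1) τ u = gammaTilt γ s τ u * (s j + γ j * u) := by
  have h3 : 0 < s j + γ j * u := add_pos_of_pos_of_nonneg (hs j) (mul_nonneg (hγ j).le hu)
  rw [gammaTilt_eq_mul_prod_erase _ _ _ _ j, gammaTilt_eq_mul_prod_erase _ _ _ _ j,
    Finset.prod_congr rfl fun i hi => by
      rw [Pi.add_apply, Pi.single_eq_of_ne (Finset.ne_of_mem_erase hi), add_zero],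
    Pi.add_apply, Pi.single_eq_same, add_right_comm, Real.Gamma_add_one h3.ne']
  ring

theorem gammaTilt_eq_add_single_right [DecidableEq ι] (hγ : ∀ i, 0 < γ i) (hτ : ∀ i, 0 < τ i)
    {u : ℝ} (hu : 0 ≤ u) (j : ι) :
    gammaTilt γ s τ u = gammaTilt γ s (τ + Pi.single j 1) u * (τ j + γ j * u) := by
  have h3 : 0 < τ j + γ j * u := add_pos_of_pos_of_nonneg (hτ j) (mul_nonneg (hγ j).le hu)
  have hG := (Real.Gamma_pos_of_pos h3).ne'
  rw [gammaTilt_eq_mul_prod_erase _ _ _ _ j, gammaTilt_eq_mul_prod_erase _ _ (τ + _) _ j,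
    Finset.prod_congr (g := fun i => Real.Gamma (s i + γ i * u) /
      Real.Gamma ((τ + Pi.single j 1 : ι → ℝ) i + γ i * u)) rfl fun i hi => by
      rw [Pi.add_apply, Pi.single_eq_of_ne (Finset.ne_of_mem_erase hi), add_zero],
    Pi.add_apply, Pi.single_eq_same, add_right_comm, Real.Gamma_add_one h3.ne']
  field_simp

end

end MultinomialPrediction

namespace MultinomialPrediction

section

variable {ι : Type*} [Fintype ι] {γ s τ : ι → ℝ}

/-! ### Moments of a gamma density tilted by ratios of Gamma functions -/

/-- The `j`-th moment of the unnormalized density `u ^ (α - 1) e ^ (-β u) gammaTilt γ s τ u`. -/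
noncomputable def tiltMoment (α β : ℝ) (γ s τ : ι → ℝ) (j : ℕ) : ℝ :=
  ∫ u in Ioi (0 : ℝ), u ^ (α - 1) * Real.exp (-β * u) * gammaTilt γ s τ u * u ^ j

variable {α β : ℝ}

theorem integrableOn_gammaDensity (hα : 0 < α) (hβ : 0 < β) :
    IntegrableOn (fun u : ℝ => u ^ (α - 1) * Real.exp (-β * u)) (Ioi 0) := by
  have := integrableOn_rpow_mul_exp_neg_mul_rpow (p := 1) (s := α - 1) (by linarith) one_pos hβ
  simpa only [Real.rpow_one] using this

theorem integrableOn_tiltMoment (hα : 0 < α) (hβ : 0 < β) (hγ : ∀ i, 0 < γ i) (hs : ∀ i, 0 < s i)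
    (hτ : ∀ i, s i ≤ τ i) (j : ℕ) :
    IntegrableOn (fun u : ℝ => u ^ (α - 1) * Real.exp (-β * u) * gammaTilt γ s τ u * u ^ j)
      (Ioi 0) := by
  have h1 : IntegrableOn (fun u : ℝ => u ^ (α + j - 1) * Real.exp (-β * u)) (Ioi 0) :=
    integrableOn_gammaDensity (by positivity) hβ
  have h2 : IntegrableOn (fun u : ℝ => u ^ (α + j - 1) * Real.exp (-β * u) * gammaTilt γ s τ u)
      (Ioi 0) := by
    refine Integrable.mul_bdd (c := gammaTilt γ s τ 0) h1
      (((gammaTilt_continuousOn hγ hs hτ).mono Ioi_subset_Ici_self).aestronglyMeasurable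
        measurableSet_Ioi) ?_
    filter_upwards [ae_restrict_mem measurableSet_Ioi] with u hu
    have hu' : (0 : ℝ) ≤ u := le_of_lt hu
    rw [Real.norm_of_nonneg (gammaTilt_pos hγ hs hτ hu').le]
    exact gammaTilt_antitoneOn hγ hs hτ self_mem_Ici hu' hu'
  refine h2.congr_fun (fun u hu => ?_) measurableSet_Ioi
  have : u ^ (α + j - 1) = u ^ (α - 1) * u ^ j := by
    rw [← Real.rpow_natCast, ← Real.rpow_add hu]
    ring_nf
  simp only [this]
  ring

theorem tiltMoment_pos (hα : 0 < α) (hβ : 0 < β) (hγ : ∀ i, 0 < γ i) (hs : ∀ i, 0 < s i)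
    (hτ : ∀ i, s i ≤ τ i) (j : ℕ) : 0 < tiltMoment α β γ s τ j := by
  have hpos : ∀ u ∈ Ioi (0 : ℝ),
      0 < u ^ (α - 1) * Real.exp (-β * u) * gammaTilt γ s τ u * u ^ j := fun u hu => by
    have h1 : (0 : ℝ) < u := hu
    have h2 := gammaTilt_pos hγ hs hτ h1.le
    positivity
  unfold tiltMoment
  rw [setIntegral_pos_iff_support_of_nonneg_ae
    ((ae_restrict_mem measurableSet_Ioi).mono fun u hu => (hpos u hu).le)
    (integrableOn_tiltMoment hα hβ hγ hs hτ j)]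
  rw [inter_eq_self_of_subset_right (show Ioi (0 : ℝ) ⊆ Function.support _ from
    fun u hu => (hpos u hu).ne')]
  simp

/-- Both the Cauchy–Schwarz step and the integration by parts lead to a cubic in `u` without
constant term. -/
theorem integral_tilt_mul_cubic (hα : 0 < α) (hβ : 0 < β) (hγ : ∀ i, 0 < γ i) (hs : ∀ i, 0 < s i)
    (hτ : ∀ i, s i ≤ τ i) (a b c : ℝ) :
    IntegrableOn (fun u : ℝ => u ^ (α - 1) * Real.exp (-β * u) * gammaTilt γ s τ u *
      (a * u + b * u ^ 2 + c * u ^ 3)) (Ioi 0) ∧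
    ∫ u in Ioi (0 : ℝ), u ^ (α - 1) * Real.exp (-β * u) * gammaTilt γ s τ u *
      (a * u + b * u ^ 2 + c * u ^ 3) =
      a * tiltMoment α β γ s τ 1 + b * tiltMoment α β γ s τ 2 + c * tiltMoment α β γ s τ 3 := by
  unfold tiltMoment
  have i1 := (integrableOn_tiltMoment hα hβ hγ hs hτ 1).const_mul a
  have i2 := (integrableOn_tiltMoment hα hβ hγ hs hτ 2).const_mul b
  have i3 := (integrableOn_tiltMoment hα hβ hγ hs hτ 3).const_mul c
  have e : (fun u : ℝ => u ^ (α - 1) * Real.exp (-β * u) * gammaTilt γ s τ u *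
      (a * u + b * u ^ 2 + c * u ^ 3)) = fun u =>
      a * (u ^ (α - 1) * Real.exp (-β * u) * gammaTilt γ s τ u * u ^ 1) +
      b * (u ^ (α - 1) * Real.exp (-β * u) * gammaTilt γ s τ u * u ^ 2) +
      c * (u ^ (α - 1) * Real.exp (-β * u) * gammaTilt γ s τ u * u ^ 3) := by
    funext u
    ring
  rw [e]
  refine ⟨(i1.add i2).add i3, ?_⟩
  rw [← integral_const_mul, ← integral_const_mul, ← integral_const_mul,
    ← integral_add i1 i2]
  exact integral_add (i1.add i2) i3

/-- Cauchy–Schwarz, obtained by integrating `u (m2 - m1 u) ^ 2 ≥ 0` against the tilted density. -/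
theorem tiltMoment_two_sq_le (hα : 0 < α) (hβ : 0 < β) (hγ : ∀ i, 0 < γ i) (hs : ∀ i, 0 < s i)
    (hτ : ∀ i, s i ≤ τ i) :
    tiltMoment α β γ s τ 2 ^ 2 ≤ tiltMoment α β γ s τ 1 * tiltMoment α β γ s τ 3 := by
  have h1 := tiltMoment_pos hα hβ hγ hs hτ 1
  set m1 := tiltMoment α β γ s τ 1
  set m2 := tiltMoment α β γ s τ 2
  set m3 := tiltMoment α β γ s τ 3
  have h := (integral_tilt_mul_cubic hα hβ hγ hs hτ (m2 ^ 2) (-2 * m1 * m2) (m1 ^ 2)).2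
  have hn : 0 ≤ ∫ u in Ioi (0 : ℝ), u ^ (α - 1) * Real.exp (-β * u) * gammaTilt γ s τ u *
      (m2 ^ 2 * u + -2 * m1 * m2 * u ^ 2 + m1 ^ 2 * u ^ 3) := by
    refine setIntegral_nonneg measurableSet_Ioi fun u hu => ?_
    have hu' : (0 : ℝ) < u := hu
    have h2 := gammaTilt_pos hγ hs hτ hu'.le
    rw [show m2 ^ 2 * u + -2 * m1 * m2 * u ^ 2 + m1 ^ 2 * u ^ 3 = u * (m2 - m1 * u) ^ 2 by ring]
    positivity
  rw [h] at hn
  have : 0 ≤ m1 * (m1 * m3 - m2 ^ 2) := by linarith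
  linarith [nonneg_of_mul_nonneg_right this h1]

/-- The function `G` below vanishes at `0` and is nonnegative at `R`, so an upper bound `g` for its
derivative has nonnegative integral over `[0, R]`; no decay at infinity is needed. The factor `M + γ
j u` in `G` is there to cancel the denominator in the bound for the logarithmic derivative of the
tilt. -/
theorem tiltMoment_integral_by_parts (hα : 0 < α) (hβ : 0 < β) (hγ : ∀ i, 0 < γ i)
    (hs : ∀ i, 0 < s i) (hτ : ∀ i, s i ≤ τ i) {M : ℝ} {j : ι} (hj : τ j = M + 1) (hM : s j ≤ M) :
    β * M * tiltMoment α β γ s τ 2 + β * γ j * tiltMoment α β γ s τ 3 +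
        γ j * (M + 1 - s j) * tiltMoment α β γ s τ 2 ≤
      (α + 1) * M * tiltMoment α β γ s τ 1 + (α + 2) * γ j * tiltMoment α β γ s τ 2 := by
  have hMpos : 0 < M := (hs j).trans_le hM
  have hγj := hγ j
  obtain ⟨hint, hval⟩ := integral_tilt_mul_cubic hα hβ hγ hs hτ ((α + 1) * M)
    ((α + 2) * γ j - β * M - γ j * (M + 1 - s j)) (-(β * γ j))
  set g : ℝ → ℝ := fun u => u ^ (α - 1) * Real.exp (-β * u) * gammaTilt γ s τ u *
    ((α + 1) * M * u + ((α + 2) * γ j - β * M - γ j * (M + 1 - s j)) * u ^ 2 +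
      -(β * γ j) * u ^ 3) with hg
  suffices 0 ≤ ∫ u in Ioi (0 : ℝ), g u by
    rw [hval] at this
    linarith
  have hlim : Tendsto (fun R : ℝ => ∫ u in (0 : ℝ)..R, g u) atTop (𝓝 (∫ u in Ioi (0 : ℝ), g u)) :=
    intervalIntegral_tendsto_integral_Ioi 0 hint tendsto_id
  refine ge_of_tendsto hlim (eventually_atTop.2 ⟨0, fun R hR => ?_⟩)
  set G : ℝ → ℝ := fun u => u ^ (α + 1) * (M + γ j * u) * Real.exp (-β * u) * gammaTilt γ s τ u
    with hG
  set k : ℝ → ℝ := fun u => ∑ i, γ i * (digamma (τ i + γ i * u) - digamma (s i + γ i * u)) with hk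
  have hcont : ContinuousOn G (Icc 0 R) := by
    refine ContinuousOn.mul ?_ ((gammaTilt_continuousOn hγ hs hτ).mono Icc_subset_Ici_self)
    refine Continuous.continuousOn (((Real.continuous_rpow_const (by linarith)).mul ?_).mul ?_) <;>
      fun_prop
  have hder : ∀ u ∈ Ioo 0 R, HasDerivWithinAt G
      (((((α + 1) * u ^ α) * (M + γ j * u) + u ^ (α + 1) * γ j) * Real.exp (-β * u) +
        u ^ (α + 1) * (M + γ j * u) * (Real.exp (-β * u) * -β)) * gammaTilt γ s τ u +
        u ^ (α + 1) * (M + γ j * u) * Real.exp (-β * u) * (-(k u) * gammaTilt γ s τ u))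
      (Ioi u) u := by
    intro u hu
    have d1 : HasDerivAt (fun u : ℝ => u ^ (α + 1)) ((α + 1) * u ^ α) u := by
      simpa using Real.hasDerivAt_rpow_const (p := α + 1) (Or.inl hu.1.ne')
    have d2 : HasDerivAt (fun u : ℝ => M + γ j * u) (γ j) u := by
      simpa using ((hasDerivAt_id u).const_mul (γ j)).const_add M
    have d3 : HasDerivAt (fun u : ℝ => Real.exp (-β * u)) (Real.exp (-β * u) * -β) u := by
      simpa using ((hasDerivAt_id u).const_mul (-β)).exp
    exact (((d1.mul d2).mul d3).mul (hasDerivAt_gammaTilt hγ hs hτ hu.1.le)).hasDerivWithinAt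
  have hle := intervalIntegral.sub_le_integral_of_hasDeriv_right_of_le hR hcont hder
    (show IntegrableOn g _ from
      (integrableOn_Icc_iff_integrableOn_Ioc (by simp)).2 (hint.mono_set Ioc_subset_Ioi_self)) ?_
  · have hG0 : G 0 = 0 := by
      simp [hG, Real.zero_rpow (by linarith : α + 1 ≠ 0)]
    have hGR : 0 ≤ G R := by
      have := (gammaTilt_pos hγ hs hτ hR).le
      simp only [hG]
      positivity
    linarith
  · intro u hu
    have hu0 : 0 < u := hu.1
    have hT := gammaTilt_pos hγ hs hτ hu0.le
    have hMu : 0 < M + γ j * u := by positivity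
    -- All summands of `k` except `j` are dropped. The unit in `τ j = M + 1` is split off exactly by
    -- the recurrence, and the digamma estimate handles the remaining gap `M - s j`.
    have hkj : γ j * ((M + 1 - s j) / (M + γ j * u)) ≤ k u := by
      refine le_trans ?_ (Finset.single_le_sum
        (fun i _ => digamma_gap_nonneg (hγ i) (hs i) (hτ i) hu0.le) (Finset.mem_univ j))
      refine mul_le_mul_of_nonneg_left ?_ hγj.le
      have h1 := div_add_le_digamma_add_sub (z := s j + γ j * u) (v := M - s j)
        (add_pos (hs j) (by positivity)) (by linarith)
      have h2 := digamma_add_one hMu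
      rw [show s j + γ j * u + (M - s j) = M + γ j * u by ring] at h1
      rw [hj, show M + 1 + γ j * u = M + γ j * u + 1 by ring, h2,
        show M + 1 - s j = (M - s j) + 1 by ring, add_div]
      linarith
    have hk' : γ j * (M + 1 - s j) ≤ (M + γ j * u) * k u := by
      have := mul_le_mul_of_nonneg_left hkj hMu.le
      calc _ = (M + γ j * u) * (γ j * ((M + 1 - s j) / (M + γ j * u))) := by
            field_simp
        _ ≤ _ := this
    have e1 : u ^ α = u ^ (α - 1) * u := by
      rw [← Real.rpow_add_one hu0.ne', sub_add_cancel]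
    have e2 : u ^ (α + 1) = u ^ (α - 1) * u ^ 2 := by
      rw [Real.rpow_add_one hu0.ne', e1]
      ring
    have hpos : 0 < u ^ (α - 1) * u ^ 2 * Real.exp (-β * u) * gammaTilt γ s τ u := by positivity
    have := mul_le_mul_of_nonneg_left hk' hpos.le
    simp only [hg, e1, e2]
    linarith

/-- With `Y = γ j m2 / m1`, Cauchy–Schwarz removes the third moment from the integration by parts
and leaves the inequality `hmain` in `Y` alone, which excludes large `Y`. -/
theorem tiltMoment_ratio_le (hα : 0 < α) (hβ : 0 < β) (hγ : ∀ i, 0 < γ i)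
    (hs : ∀ i, 0 < s i) (hτ : ∀ i, s i ≤ τ i) {M t : ℝ} {j : ι} (hj : τ j = M + 1) (hM : s j ≤ M)
    (ht1 : t ≤ 1) (hK : (α + 1) * γ j / (β + γ j) + t * M ≤ M - s j) :
    t * (γ j * tiltMoment α β γ s τ 2) ≤ ((1 - t) * M - s j) * tiltMoment α β γ s τ 1 := by
  have hMpos : 0 < M := (hs j).trans_le hM
  have hγj := hγ j
  have h1 := tiltMoment_pos hα hβ hγ hs hτ 1
  have h2 := tiltMoment_pos hα hβ hγ hs hτ 2
  have hCS := tiltMoment_two_sq_le hα hβ hγ hs hτ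
  have hI := tiltMoment_integral_by_parts hα hβ hγ hs hτ hj hM
  set m1 := tiltMoment α β γ s τ 1
  set m2 := tiltMoment α β γ s τ 2
  set m3 := tiltMoment α β γ s τ 3
  set K := (α + 1) * γ j / (β + γ j) with hKdef
  have hKpos : 0 < K := by positivity
  have hKeq : K * (β + γ j) = (α + 1) * γ j := div_mul_cancel₀ _ (by positivity)
  obtain ⟨Y, hY⟩ : ∃ Y, γ j * m2 = Y * m1 := ⟨γ j * m2 / m1, (div_mul_cancel₀ _ h1.ne').symm⟩
  have hYpos : 0 < Y := pos_of_mul_pos_left (hY ▸ mul_pos hγj h2) h1.le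
  have hm3 : Y ^ 2 * m1 ≤ γ j ^ 2 * m3 := by
    have : m1 * (Y ^ 2 * m1) ≤ m1 * (γ j ^ 2 * m3) := by
      calc m1 * (Y ^ 2 * m1) = γ j ^ 2 * m2 ^ 2 := by
            rw [← mul_pow, hY]; ring
        _ ≤ γ j ^ 2 * (m1 * m3) := by gcongr
        _ = _ := by ring
    exact le_of_mul_le_mul_left this h1
  have hmain : β * Y * (M + Y) + γ j * (M - s j) * Y ≤ (α + 1) * γ j * (M + Y) := by
    have hI' := mul_le_mul_of_nonneg_left hI hγj.le
    have e : m1 * (β * Y * (M + Y) + γ j * (M - s j) * Y) ≤ m1 * ((α + 1) * γ j * (M + Y)) := by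
      have a1 : γ j * (β * M * m2) = β * M * (Y * m1) := by rw [← hY]; ring
      have a2 : γ j * (γ j * (M + 1 - s j) * m2) = γ j * (M + 1 - s j) * (Y * m1) := by
        rw [← hY]; ring
      have a3 : γ j * ((α + 2) * γ j * m2) = (α + 2) * γ j * (Y * m1) := by rw [← hY]; ring
      have a4 := mul_le_mul_of_nonneg_left hm3 hβ.le
      linarith
    exact le_of_mul_le_mul_left e h1
  -- Otherwise `hK` yields `K < t Y ≤ Y` and `K (M + Y) ≤ (M - s j) Y`. Then the left side of
  -- `hmain` exceeds `(β + γ j) K (M + Y)`, which by the choice of `K` is its right side.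
  have hgoal : t * Y ≤ (1 - t) * M - s j := by
    by_contra hcon
    push Not at hcon
    have b1 : K < t * Y := by linarith
    have b2 : K < Y := b1.trans_le (mul_le_of_le_one_left hYpos.le ht1)
    have b3 : K * (M + Y) ≤ (M - s j) * Y := by
      have := mul_le_mul_of_nonneg_right hK hYpos.le
      have := mul_le_mul_of_nonneg_right b1.le hMpos.le
      linarith
    have b4 := mul_le_mul_of_nonneg_left b3 hγj.le
    have b5 : β * K * (M + Y) < β * Y * (M + Y) :=
      mul_lt_mul_of_pos_right (mul_lt_mul_of_pos_left b2 hβ) (by linarith)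
    have b6 : K * (β + γ j) * (M + Y) = (α + 1) * γ j * (M + Y) := by rw [hKeq]
    linarith
  calc t * (γ j * m2) = t * Y * m1 := by rw [hY]; ring
    _ ≤ _ := mul_le_mul_of_nonneg_right hgoal h1.le

/-! ### Shifts of the parameters -/

theorem le_add_single {κ : Type*} [DecidableEq κ] (τ : κ → ℝ) (j i : κ) :
    τ i ≤ (τ + Pi.single j 1 : κ → ℝ) i := by
  rw [Pi.add_apply, Pi.single_apply]
  split_ifs <;> simp

variable [DecidableEq ι]

theorem tiltMoment_add_single_left (hα : 0 < α) (hβ : 0 < β) (hγ : ∀ i, 0 < γ i)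
    (hs : ∀ i, 0 < s i) (hτ : ∀ i, s i ≤ τ i) (j : ι) (k : ℕ) :
    tiltMoment α β γ (s + Pi.single j 1) τ k =
      s j * tiltMoment α β γ s τ k + γ j * tiltMoment α β γ s τ (k + 1) := by
  have i1 := (integrableOn_tiltMoment hα hβ hγ hs hτ k).const_mul (s j)
  have i2 := (integrableOn_tiltMoment hα hβ hγ hs hτ (k + 1)).const_mul (γ j)
  unfold tiltMoment
  rw [← integral_const_mul, ← integral_const_mul, ← integral_add i1 i2]
  refine setIntegral_congr_fun measurableSet_Ioi fun u hu => ?_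
  simp only [gammaTilt_add_single_left hγ hs (le_of_lt hu) j]
  ring

theorem tiltMoment_eq_add_single_right (hα : 0 < α) (hβ : 0 < β) (hγ : ∀ i, 0 < γ i)
    (hs : ∀ i, 0 < s i) (hτ : ∀ i, s i ≤ τ i) (j : ι) (k : ℕ) :
    tiltMoment α β γ s τ k = τ j * tiltMoment α β γ s (τ + Pi.single j 1) k +
      γ j * tiltMoment α β γ s (τ + Pi.single j 1) (k + 1) := by
  have hτ0 : ∀ i, 0 < τ i := fun i => (hs i).trans_le (hτ i)
  have hτ' : ∀ i, s i ≤ (τ + Pi.single j 1 : ι → ℝ) i := fun i => (hτ i).trans (le_add_single τ j i)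
  have i1 := (integrableOn_tiltMoment hα hβ hγ hs hτ' k).const_mul (τ j)
  have i2 := (integrableOn_tiltMoment hα hβ hγ hs hτ' (k + 1)).const_mul (γ j)
  unfold tiltMoment
  rw [← integral_const_mul, ← integral_const_mul, ← integral_add i1 i2]
  refine setIntegral_congr_fun measurableSet_Ioi fun u hu => ?_
  simp only [gammaTilt_eq_add_single_right hγ hτ0 (le_of_lt hu) j]
  ring

end

end MultinomialPrediction

namespace MultinomialPrediction

section

/-! ### The Dirichlet integral -/

/-- The power `t ^ (b - 1)` on the positive half-line, extended by zero. -/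
noncomputable def powPos (b t : ℝ) : ℝ := if 0 < t then t ^ (b - 1) else 0

theorem powPos_nonneg (b t : ℝ) : 0 ≤ powPos b t := by
  unfold powPos
  split_ifs with h
  · exact Real.rpow_nonneg h.le _
  · exact le_rfl

theorem measurable_powPos (b : ℝ) : Measurable (powPos b) :=
  Measurable.ite measurableSet_Ioi (measurable_id.pow_const _) measurable_const

theorem lintegral_eq_mul_lintegral_comp_const_mul {c : ℝ} (hc : 0 < c)
    {f : ℝ → ENNReal} (hf : Measurable f) :
    ∫⁻ t, f t = ENNReal.ofReal c * ∫⁻ t, f (c * t) := by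
  have h := Real.smul_map_volume_mul_left hc.ne'
  rw [abs_of_pos hc] at h
  conv_lhs => rw [← h]
  rw [lintegral_smul_measure, lintegral_map hf (measurable_const_mul c), smul_eq_mul]

/-- Rescaling `t` by `S` turns the integrand into a multiple of the Beta density. For `S ≤ 0` the
two supports are disjoint and both sides vanish. -/
theorem lintegral_powPos_mul_powPos {a b : ℝ} (ha : 0 < a) (hb : 0 < b) (S : ℝ) :
    ∫⁻ t, ENNReal.ofReal (powPos a (S - t)) * ENNReal.ofReal (powPos b t) =
      ENNReal.ofReal (ProbabilityTheory.beta b a * powPos (a + b) S) := by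
  rcases le_or_gt S 0 with hS | hS
  · rw [show powPos (a + b) S = 0 from if_neg (not_lt.2 hS), mul_zero, ENNReal.ofReal_zero]
    refine (lintegral_congr fun t => ?_).trans lintegral_zero
    by_cases ht : 0 < t
    · rw [show powPos a (S - t) = 0 from if_neg (by linarith), ENNReal.ofReal_zero, zero_mul]
    · rw [show powPos b t = 0 from if_neg ht, ENNReal.ofReal_zero, mul_zero]
  · have hB := ProbabilityTheory.beta_pos hb ha
    have hm : Measurable fun t =>
        ENNReal.ofReal (powPos a (S - t)) * ENNReal.ofReal (powPos b t) :=
      ((measurable_powPos a).comp (measurable_id.const_sub S)).ennreal_ofReal.mul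
        (measurable_powPos b).ennreal_ofReal
    have key : ∀ t, ENNReal.ofReal (powPos a (S - S * t)) * ENNReal.ofReal (powPos b (S * t)) =
        ENNReal.ofReal (S ^ (a - 1) * S ^ (b - 1) * ProbabilityTheory.beta b a) *
          ProbabilityTheory.betaPDF b a t := by
      intro t
      rw [ProbabilityTheory.betaPDF, ProbabilityTheory.betaPDFReal,
        ← ENNReal.ofReal_mul (powPos_nonneg _ _), ← ENNReal.ofReal_mul (by positivity)]
      congr 1
      have e1 : 0 < S - S * t ↔ t < 1 := by
        rw [show S - S * t = S * (1 - t) by ring, mul_pos_iff_of_pos_left hS, sub_pos]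
      have e2 : 0 < S * t ↔ 0 < t := mul_pos_iff_of_pos_left hS
      simp only [powPos, e1, e2]
      by_cases h0 : 0 < t <;> by_cases h1 : t < 1
      · rw [if_pos h1, if_pos h0, if_pos ⟨h0, h1⟩, show S - S * t = S * (1 - t) by ring,
          Real.mul_rpow hS.le (by linarith), Real.mul_rpow hS.le h0.le]
        field_simp
      all_goals simp [h0, h1]
    rw [lintegral_eq_mul_lintegral_comp_const_mul hS hm, lintegral_congr key,
      lintegral_const_mul' _ _ ENNReal.ofReal_ne_top,
      ProbabilityTheory.lintegral_betaPDF_eq_one hb ha, mul_one, ← ENNReal.ofReal_mul hS.le]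
    congr 1
    rw [powPos, if_pos hS, show a + b - 1 = (a - 1) + (b - 1) + 1 by ring, Real.rpow_add_one hS.ne',
      Real.rpow_add hS]
    ring

/-- The value `Γ(b₀) ∏ Γ(b i) / Γ(b₀ + ∑ b i)` of the Dirichlet integral. -/
noncomputable def dirichletConst {n : ℕ} (b₀ : ℝ) (b : Fin n → ℝ) : ℝ :=
  Real.Gamma b₀ * (∏ i, Real.Gamma (b i)) / Real.Gamma (b₀ + ∑ i, b i)

theorem dirichletConst_pos {n : ℕ} {b₀ : ℝ} {b : Fin n → ℝ} (hb₀ : 0 < b₀) (hb : ∀ i, 0 < b i) :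
    0 < dirichletConst b₀ b :=
  div_pos (mul_pos (Real.Gamma_pos_of_pos hb₀)
    (Finset.prod_pos fun i _ => Real.Gamma_pos_of_pos (hb i)))
    (Real.Gamma_pos_of_pos (add_pos_of_pos_of_nonneg hb₀ (Finset.sum_nonneg fun i _ => (hb i).le)))

/-- Fixing the first coordinate `x` leaves the same integral in one dimension less with `S - x` in
place of `S`. The induction therefore needs every real `S`, not only `S = 1`. -/
theorem lintegral_dirichlet {n : ℕ} {b₀ : ℝ} {b : Fin n → ℝ} (hb₀ : 0 < b₀) (hb : ∀ i, 0 < b i)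
    (S : ℝ) :
    ∫⁻ p : Fin n → ℝ, ENNReal.ofReal (powPos b₀ (S - ∑ i, p i) * ∏ i, powPos (b i) (p i)) =
      ENNReal.ofReal (dirichletConst b₀ b * powPos (b₀ + ∑ i, b i) S) := by
  induction n generalizing S with
  | zero =>
    have hG := (Real.Gamma_pos_of_pos hb₀).ne'
    simp [dirichletConst, lintegral_unique, hG, volume_pi]
  | succ n ih =>
    have ih' := ih (b := fun i => b i.succ) (fun i => hb _)
    have hsum : 0 < b₀ + ∑ i : Fin n, b i.succ :=
      add_pos_of_pos_of_nonneg hb₀ (Finset.sum_nonneg fun i _ => (hb _).le)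
    have hmp := (volume_preserving_piFinSuccAbove (fun _ : Fin (n + 1) => ℝ) 0).symm
    have hmeas : Measurable fun p : Fin (n + 1) → ℝ =>
        ENNReal.ofReal (powPos b₀ (S - ∑ i, p i) * ∏ i, powPos (b i) (p i)) := by
      refine Measurable.ennreal_ofReal (Measurable.mul ((measurable_powPos _).comp ?_) ?_)
      · fun_prop
      · exact Finset.measurable_fun_prod _ fun i _ =>
          (measurable_powPos _).comp (measurable_pi_apply i)
    rw [← hmp.lintegral_comp hmeas]
    refine (lintegral_prod _ (hmeas.comp hmp.measurable).aemeasurable).trans ?_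
    simp only [Function.comp_apply]
    have key : ∀ x : ℝ, ∫⁻ p : Fin n → ℝ, ENNReal.ofReal (powPos b₀ (S - ∑ i,
        (MeasurableEquiv.piFinSuccAbove (fun _ : Fin (n + 1) => ℝ) 0).symm (x, p) i) *
        ∏ i, powPos (b i)
          ((MeasurableEquiv.piFinSuccAbove (fun _ : Fin (n + 1) => ℝ) 0).symm (x, p) i)) =
        ENNReal.ofReal (dirichletConst b₀ fun i => b i.succ) *
          (ENNReal.ofReal (powPos (b₀ + ∑ i : Fin n, b i.succ) (S - x)) *
            ENNReal.ofReal (powPos (b 0) x)) := by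
      intro x
      rw [← mul_assoc, ← ENNReal.ofReal_mul (dirichletConst_pos hb₀ fun i => hb _).le, ← ih',
        mul_comm, ← lintegral_const_mul' _ _ ENNReal.ofReal_ne_top]
      refine lintegral_congr fun p => ?_
      rw [← ENNReal.ofReal_mul (powPos_nonneg _ _)]
      congr 1
      simp only [MeasurableEquiv.piFinSuccAbove_symm_apply, Fin.insertNthEquiv_apply,
        Fin.insertNth_zero', Fin.sum_univ_succ, Fin.prod_univ_succ, Fin.cons_zero, Fin.cons_succ]
      rw [show S - (x + ∑ i : Fin n, p i) = S - x - ∑ i : Fin n, p i by ring]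
      ring
    rw [lintegral_congr key, lintegral_const_mul' _ _ ENNReal.ofReal_ne_top,
      lintegral_powPos_mul_powPos hsum (hb 0),
      ← ENNReal.ofReal_mul (dirichletConst_pos hb₀ fun i => hb _).le]
    congr 1
    have hG := (Real.Gamma_pos_of_pos hsum).ne'
    rw [Fin.sum_univ_succ, show b₀ + (b 0 + ∑ i : Fin n, b i.succ) =
      b₀ + ∑ i : Fin n, b i.succ + b 0 by ring, ← mul_assoc]
    congr 1
    rw [dirichletConst, dirichletConst, ProbabilityTheory.beta, Fin.prod_univ_succ,
      Fin.sum_univ_succ, show b₀ + (b 0 + ∑ i : Fin n, b i.succ) =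
      b₀ + ∑ i : Fin n, b i.succ + b 0 by ring, add_comm (b 0) (b₀ + _)]
    field_simp

theorem integral_dirichlet {n : ℕ} {b₀ : ℝ} {b : Fin n → ℝ} (hb₀ : 0 < b₀) (hb : ∀ i, 0 < b i) :
    Integrable (fun p : Fin n → ℝ => powPos b₀ (1 - ∑ i, p i) * ∏ i, powPos (b i) (p i)) ∧
    ∫ p : Fin n → ℝ, powPos b₀ (1 - ∑ i, p i) * ∏ i, powPos (b i) (p i) = dirichletConst b₀ b := by
  have h := lintegral_dirichlet hb₀ hb 1
  have hone : powPos (b₀ + ∑ i, b i) 1 = 1 := by simp [powPos]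
  rw [hone, mul_one] at h
  have hnn : ∀ p : Fin n → ℝ, 0 ≤ powPos b₀ (1 - ∑ i, p i) * ∏ i, powPos (b i) (p i) := fun p =>
    mul_nonneg (powPos_nonneg _ _) (Finset.prod_nonneg fun i _ => powPos_nonneg _ _)
  have hm : Measurable fun p : Fin n → ℝ =>
      powPos b₀ (1 - ∑ i, p i) * ∏ i, powPos (b i) (p i) := by
    refine Measurable.mul ((measurable_powPos _).comp (by fun_prop)) ?_
    exact Finset.measurable_fun_prod _ fun i _ => (measurable_powPos _).comp (measurable_pi_apply i)
  constructor
  · refine ⟨hm.aestronglyMeasurable, ?_⟩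
    rw [hasFiniteIntegral_iff_ofReal (ae_of_all _ hnn), h]
    exact ENNReal.ofReal_lt_top
  · rw [integral_eq_lintegral_of_nonneg_ae (ae_of_all _ hnn) hm.aestronglyMeasurable, h,
      ENNReal.toReal_ofReal (dirichletConst_pos hb₀ hb).le]

/-! ### Dirichlet integrals over a product of simplices. -/

variable {N : ℕ} {m : Fin N → ℕ}

theorem measurableSet_paramSpace : MeasurableSet (paramSpace m) := by
  have : paramSpace m = ⋂ ν, ((⋂ i, {p : Param m | 0 < p ν i}) ∩ {p | ∑ i, p ν i < 1}) := by
    ext p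
    simp [paramSpace]
  rw [this]
  refine MeasurableSet.iInter fun ν => (MeasurableSet.iInter fun i => ?_).inter ?_
  · exact measurableSet_lt measurable_const (by fun_prop)
  · exact measurableSet_lt (by fun_prop) measurable_const

theorem p₀_pos {p : Param m} (hp : p ∈ paramSpace m) (ν : Fin N) : 0 < p₀ p ν :=
  sub_pos.2 (hp ν).2

/-- The unnormalized density of a product of Dirichlet distributions. -/
noncomputable def dirichletKernel (b₀ : Fin N → ℝ) (b : ∀ ν, Fin (m ν) → ℝ) (p : Param m) : ℝ :=
  ∏ ν, (p₀ p ν ^ (b₀ ν - 1) * ∏ i, p ν i ^ (b ν i - 1))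

theorem dirichletKernel_pos (b₀ : Fin N → ℝ) (b : ∀ ν, Fin (m ν) → ℝ) {p : Param m}
    (hp : p ∈ paramSpace m) : 0 < dirichletKernel b₀ b p :=
  Finset.prod_pos fun ν _ => mul_pos (Real.rpow_pos_of_pos (p₀_pos hp ν) _)
    (Finset.prod_pos fun i _ => Real.rpow_pos_of_pos ((hp ν).1 i) _)

/-- Extension by zero makes the integrand a product of functions of the separate blocks on the whole
space, so its integral factors. -/
theorem indicator_dirichletKernel (b₀ : Fin N → ℝ) (b : ∀ ν, Fin (m ν) → ℝ) :
    (paramSpace m).indicator (dirichletKernel b₀ b) = fun p =>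
      ∏ ν, (powPos (b₀ ν) (1 - ∑ i, p ν i) * ∏ i, powPos (b ν i) (p ν i)) := by
  funext p
  by_cases hp : p ∈ paramSpace m
  · rw [indicator_of_mem hp]
    refine Finset.prod_congr rfl fun ν _ => ?_
    rw [powPos, if_pos (show 0 < 1 - ∑ i, p ν i from p₀_pos hp ν)]
    congr 1
    exact Finset.prod_congr rfl fun i _ => by rw [powPos, if_pos ((hp ν).1 i)]
  · rw [indicator_of_notMem hp]
    simp only [paramSpace, mem_ofPred_eq, not_forall] at hp
    obtain ⟨ν, hν⟩ := hp
    refine (Finset.prod_eq_zero (Finset.mem_univ ν) ?_).symm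
    rw [not_and_or] at hν
    rcases hν with h | h
    · push Not at h
      obtain ⟨i, hi⟩ := h
      rw [Finset.prod_eq_zero (Finset.mem_univ i) (if_neg (not_lt.2 hi)), mul_zero]
    · rw [powPos, if_neg (by linarith), zero_mul]

theorem integral_dirichletKernel {b₀ : Fin N → ℝ} {b : ∀ ν, Fin (m ν) → ℝ} (hb₀ : ∀ ν, 0 < b₀ ν)
    (hb : ∀ ν i, 0 < b ν i) :
    IntegrableOn (dirichletKernel b₀ b) (paramSpace m) ∧
    ∫ p in paramSpace m, dirichletKernel b₀ b p = ∏ ν, dirichletConst (b₀ ν) (b ν) := by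
  rw [← integrable_indicator_iff measurableSet_paramSpace,
    ← integral_indicator measurableSet_paramSpace, indicator_dirichletKernel]
  refine ⟨Integrable.fintype_prod_dep
    (f := fun ν (q : Fin (m ν) → ℝ) => powPos (b₀ ν) (1 - ∑ i, q i) * ∏ i, powPos (b ν i) (q i))
    fun ν => (integral_dirichlet (hb₀ ν) (hb ν)).1, ?_⟩
  rw [integral_fintype_prod_volume_eq_prod
    (f := fun ν (q : Fin (m ν) → ℝ) => powPos (b₀ ν) (1 - ∑ i, q i) * ∏ i, powPos (b ν i) (q i))]
  exact Finset.prod_congr rfl fun ν _ => (integral_dirichlet (hb₀ ν) (hb ν)).2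

end

end MultinomialPrediction

namespace MultinomialPrediction

section

variable {N L : ℕ} {m : Fin N → ℕ} {d : Fin L → ℕ} {nu : ∀ t : Fin L, Fin (d t) → Fin N}
  {l : Fin L → ℕ}

/-! ### Counts of the categories in a family of tables -/

/-- The multiplicity of the category `k` of the `ν`-th probability vector in a cell index. -/
def cellMult {t : Fin L} (i : Cell m nu t) (ν : Fin N) (k : ℕ) : ℕ :=
  ∑ h, if nu t h = ν ∧ (i h : ℕ) = k then 1 else 0

/-- The exponent of the probability of the category `k` of the `ν`-th vector in `tableMass`. -/
def categoryCount (w : Tables m nu l) (ν : Fin N) (k : ℕ) : ℕ :=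
  ∑ t, ∑ i : Cell m nu t, cellMult i ν k * (w t).1 i

/-- The product of the multinomial coefficients of a family of tables. -/
noncomputable def tableCoeff (w : Tables m nu l) : ℝ :=
  ∏ t, ((l t)! : ℝ) / (∏ i, (((w t).1 i)! : ℝ))

theorem tableCoeff_pos (w : Tables m nu l) : 0 < tableCoeff w :=
  Finset.prod_pos fun t _ => by positivity

/-- The monomial `∏ p₀ ^ c₀ ∏ p ^ c`. -/
noncomputable def probMonomial (c₀ : Fin N → ℕ) (c : ∀ ν, Fin (m ν) → ℕ) (p : Param m) : ℝ :=
  ∏ ν, (p₀ p ν ^ c₀ ν * ∏ j, p ν j ^ c ν j)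

theorem probMonomial_zero (p : Param m) : probMonomial 0 (fun _ _ => 0) p = 1 := by
  simp [probMonomial]

theorem probMonomial_pos (c₀ : Fin N → ℕ) (c : ∀ ν, Fin (m ν) → ℕ) {p : Param m}
    (hp : p ∈ paramSpace m) : 0 < probMonomial c₀ c p :=
  Finset.prod_pos fun ν _ => mul_pos (pow_pos (p₀_pos hp ν) _)
    (Finset.prod_pos fun i _ => pow_pos ((hp ν).1 i) _)

theorem prod_probMonomial {κ : Type*} [Fintype κ] (c₀ : κ → Fin N → ℕ)
    (c : κ → ∀ ν, Fin (m ν) → ℕ) (p : Param m) :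
    ∏ k, probMonomial (c₀ k) (c k) p =
      probMonomial (fun ν => ∑ k, c₀ k ν) (fun ν j => ∑ k, c k ν j) p := by
  unfold probMonomial
  rw [Finset.prod_comm]
  refine Finset.prod_congr rfl fun ν _ => ?_
  rw [Finset.prod_mul_distrib, Finset.prod_pow_eq_pow_sum, Finset.prod_comm]
  congr 1
  exact Finset.prod_congr rfl fun j _ => Finset.prod_pow_eq_pow_sum _ _ _

theorem probMonomial_pow (c₀ : Fin N → ℕ) (c : ∀ ν, Fin (m ν) → ℕ) (p : Param m) (k : ℕ) :
    probMonomial c₀ c p ^ k = probMonomial (fun ν => c₀ ν * k) (fun ν j => c ν j * k) p := by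
  simp only [probMonomial, ← Finset.prod_pow, mul_pow, pow_mul]

theorem fullProb_eq_probMonomial (p : Param m) (ν : Fin N) (k : Fin (m ν + 1)) :
    fullProb p ν k = probMonomial (fun μ => if ν = μ ∧ (k : ℕ) = 0 then 1 else 0)
      (fun μ j => if ν = μ ∧ (k : ℕ) = j + 1 then 1 else 0) p := by
  unfold probMonomial
  rw [Finset.prod_eq_single ν]
  · refine Fin.cases ?_ (fun i => ?_) k
    · simp [fullProb]
    · rw [Finset.prod_eq_single i]
      · simp [fullProb]
      · intro j _ hj
        simp [Fin.val_inj, hj.symm]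
      · simp
  · intro μ _ hμ
    simp [hμ.symm]
  · simp

theorem tableMass_eq (p : Param m) (w : Tables m nu l) :
    tableMass p w = tableCoeff w * probMonomial (fun ν => categoryCount w ν 0)
      (fun ν j => categoryCount w ν (j + 1)) p := by
  unfold tableMass tableCoeff categoryCount cellMult
  simp only [fullProb_eq_probMonomial, prod_probMonomial, probMonomial_pow,
    Finset.prod_mul_distrib]

theorem tableMass_pos {p : Param m} (hp : p ∈ paramSpace m) (w : Tables m nu l) :
    0 < tableMass p w := by
  rw [tableMass_eq]
  exact mul_pos (tableCoeff_pos w) (probMonomial_pos _ _ hp)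

/-- Since `nu t` is injective, a cell involves each probability vector at most once, and then in
exactly one category. -/
theorem sum_cellMult (hnu : ∀ t, StrictMono (nu t)) {t : Fin L} (i : Cell m nu t) (ν : Fin N) :
    cellMult i ν 0 + ∑ j : Fin (m ν), cellMult i ν (j + 1) = if ∃ h, nu t h = ν then 1 else 0 := by
  have key : ∀ h, ((if nu t h = ν ∧ (i h : ℕ) = 0 then 1 else 0) +
      ∑ j : Fin (m ν), if nu t h = ν ∧ (i h : ℕ) = j + 1 then 1 else 0) =
      if nu t h = ν then 1 else 0 := by
    intro h
    by_cases hν : nu t h = ν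
    · subst hν
      simp only [true_and, if_true]
      refine Fin.cases ?_ (fun k => ?_) (i h)
      · simp
      · simp [Fin.val_inj]
    · simp [hν]
  unfold cellMult
  rw [Finset.sum_comm, ← Finset.sum_add_distrib, Finset.sum_congr rfl fun h _ => key h]
  by_cases hex : ∃ h, nu t h = ν
  · obtain ⟨h₀, rfl⟩ := hex
    rw [if_pos ⟨h₀, rfl⟩, Finset.sum_eq_single h₀]
    · simp
    · intro h _ hne
      exact if_neg fun he => hne ((hnu t).injective he)
    · simp
  · rw [if_neg hex]
    exact Finset.sum_eq_zero fun h _ => if_neg fun he => hex ⟨h, he⟩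

/-- The number of draws from each vector is the same for all `w`. Hence only the category-0 counts
of `w` survive in the log ratio of the predictive masses. -/
theorem sum_categoryCount (hnu : ∀ t, StrictMono (nu t)) (w : Tables m nu l) (ν : Fin N) :
    categoryCount w ν 0 + ∑ j : Fin (m ν), categoryCount w ν (j + 1) = totalCount nu l ν := by
  classical
  have : ∀ t, (∑ i : Cell m nu t, cellMult i ν 0 * (w t).1 i) +
      ∑ j : Fin (m ν), ∑ i : Cell m nu t, cellMult i ν (j + 1) * (w t).1 i =
      if ∃ h, nu t h = ν then l t else 0 := by
    intro t
    rw [Finset.sum_comm, ← Finset.sum_add_distrib]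
    simp only [← Finset.sum_mul, ← add_mul, sum_cellMult hnu]
    rw [← Finset.mul_sum, (w t).2]
    split_ifs <;> simp
  unfold categoryCount totalCount
  rw [Finset.sum_comm, ← Finset.sum_add_distrib, Finset.sum_congr rfl fun t _ => this t,
    Finset.sum_filter]

/-! ### Posterior integrals -/

/-- The coefficient of the negative multinomial mass function. -/
noncomputable def obsCoeff (r : Fin N → ℝ) (x : Obs m) : ℝ :=
  ∏ ν, Real.Gamma (r ν + ∑ i, (x ν i : ℝ)) / (Real.Gamma (r ν) * ∏ i, ((x ν i)! : ℝ))

theorem obsCoeff_pos {r : Fin N → ℝ} (hr : ∀ ν, 0 < r ν) (x : Obs m) : 0 < obsCoeff r x :=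
  Finset.prod_pos fun ν _ => by
    have h1 := Real.Gamma_pos_of_pos (hr ν)
    have h2 : 0 < Real.Gamma (r ν + ∑ i, (x ν i : ℝ)) := Real.Gamma_pos_of_pos
      (add_pos_of_pos_of_nonneg (hr ν) (Finset.sum_nonneg fun i _ => Nat.cast_nonneg _))
    positivity

theorem negMultinomialMass_eq (r : Fin N → ℝ) (p : Param m) (x : Obs m) :
    negMultinomialMass r p x = obsCoeff r x * ∏ ν, (p₀ p ν ^ r ν * ∏ i, p ν i ^ x ν i) := by
  unfold negMultinomialMass obsCoeff
  rw [← Finset.prod_mul_distrib]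
  exact Finset.prod_congr rfl fun ν _ => mul_assoc _ _ _

theorem negMultinomialMass_pos {r : Fin N → ℝ} (hr : ∀ ν, 0 < r ν) {p : Param m}
    (hp : p ∈ paramSpace m) (x : Obs m) : 0 < negMultinomialMass r p x := by
  rw [negMultinomialMass_eq]
  exact mul_pos (obsCoeff_pos hr x) (Finset.prod_pos fun ν _ =>
    mul_pos (Real.rpow_pos_of_pos (p₀_pos hp ν) _) (Finset.prod_pos fun i _ =>
      pow_pos ((hp ν).1 i) _))

theorem probMonomial_mul_dirichletKernel (r : Fin N → ℝ) (x : Obs m) (c₀ : Fin N → ℕ)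
    (c : ∀ ν, Fin (m ν) → ℕ) (b₀ : Fin N → ℝ) (b : ∀ ν, Fin (m ν) → ℝ) {p : Param m}
    (hp : p ∈ paramSpace m) :
    probMonomial c₀ c p * (negMultinomialMass r p x * dirichletKernel b₀ b p) =
      obsCoeff r x * dirichletKernel (fun ν => r ν + b₀ ν + c₀ ν)
        (fun ν i => x ν i + b ν i + c ν i) p := by
  rw [negMultinomialMass_eq, mul_assoc, mul_left_comm]
  congr 1
  unfold probMonomial dirichletKernel
  rw [← Finset.prod_mul_distrib, ← Finset.prod_mul_distrib]
  refine Finset.prod_congr rfl fun ν _ => ?_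
  have h0 := p₀_pos hp ν
  have e0 : p₀ p ν ^ (r ν + b₀ ν + c₀ ν - 1) =
      p₀ p ν ^ c₀ ν * (p₀ p ν ^ r ν * p₀ p ν ^ (b₀ ν - 1)) := by
    rw [← Real.rpow_natCast, ← Real.rpow_add h0, ← Real.rpow_add h0]
    ring_nf
  have e1 : ∏ i, p ν i ^ ((x ν i : ℝ) + b ν i + c ν i - 1) =
      (∏ i, p ν i ^ c ν i) * ((∏ i, p ν i ^ x ν i) * ∏ i, p ν i ^ (b ν i - 1)) := by
    rw [← Finset.prod_mul_distrib, ← Finset.prod_mul_distrib]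
    refine Finset.prod_congr rfl fun i _ => ?_
    have hi := (hp ν).1 i
    rw [← Real.rpow_natCast, ← Real.rpow_natCast, ← Real.rpow_add hi, ← Real.rpow_add hi]
    ring_nf
  rw [e0, e1]
  ring

variable {r a₀ : Fin N → ℝ} {a : ∀ ν : Fin N, Fin (m ν) → ℝ}

theorem integral_probMonomial_dirichletPrior (ha : ∀ ν i, 0 < a ν i) (hra : ∀ ν, 0 < r ν + a₀ ν)
    (x : Obs m) (c₀ : Fin N → ℕ) (c : ∀ ν, Fin (m ν) → ℕ) :
    ∫ p in paramSpace m, probMonomial c₀ c p *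
        (negMultinomialMass r p x * dirichletPrior a₀ a p) =
      obsCoeff r x * ∏ ν, dirichletConst (r ν + a₀ ν + c₀ ν)
        (fun i => x ν i + a ν i + c ν i) := by
  rw [← (integral_dirichletKernel (b₀ := fun ν => r ν + a₀ ν + c₀ ν)
    (b := fun ν i => x ν i + a ν i + c ν i) (fun ν => add_pos_of_pos_of_nonneg (hra ν) (by positivity))
    (fun ν i => by have := ha ν i; positivity)).2, ← integral_const_mul]
  exact setIntegral_congr_fun measurableSet_paramSpace fun p hp =>
    probMonomial_mul_dirichletKernel r x c₀ c a₀ a hp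

/-- This is the origin of `gammaTilt`: adding `γ ν u` to the exponent of `p₀` changes two Gamma
factors per block and leaves the `Γ(b ν i)` alone. -/
theorem prod_dirichletConst (γ b₀ : Fin N → ℝ) (b : ∀ ν, Fin (m ν) → ℝ) (u : ℝ) :
    ∏ ν, dirichletConst (b₀ ν + γ ν * u) (b ν) =
      (∏ ν, ∏ i, Real.Gamma (b ν i)) *
        gammaTilt γ b₀ (fun ν => b₀ ν + ∑ i, b ν i) u := by
  unfold dirichletConst gammaTilt
  rw [← Finset.prod_mul_distrib]
  refine Finset.prod_congr rfl fun ν _ => ?_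
  rw [add_right_comm]
  ring

variable {α β : ℝ} {γ : Fin N → ℝ}

/-- Fubini. The integrand is positive, so joint integrability is checked by integrating over `p`
first, where the Dirichlet integral is explicit. -/
theorem integral_integral_dirichletKernel (hα : 0 < α) (hβ : 0 < β) (hγ : ∀ ν, 0 < γ ν)
    {b₀ : Fin N → ℝ} {b : ∀ ν, Fin (m ν) → ℝ} (hb₀ : ∀ ν, 0 < b₀ ν) (hb : ∀ ν i, 0 < b ν i) :
    ∫ p in paramSpace m, ∫ u in Ioi (0 : ℝ), u ^ (α - 1) * Real.exp (-β * u) *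
        dirichletKernel (fun ν => b₀ ν + γ ν * u) b p =
      (∏ ν, ∏ i, Real.Gamma (b ν i)) *
        tiltMoment α β γ b₀ (fun ν => b₀ ν + ∑ i, b ν i) 0 := by
  have hτ : ∀ ν, b₀ ν ≤ b₀ ν + ∑ i, b ν i := fun ν =>
    le_add_of_nonneg_right (Finset.sum_nonneg fun i _ => (hb ν i).le)
  have hval : ∀ u ∈ Ioi (0 : ℝ), IntegrableOn (dirichletKernel (fun ν => b₀ ν + γ ν * u) b)
      (paramSpace m) ∧ ∫ p in paramSpace m, dirichletKernel (fun ν => b₀ ν + γ ν * u) b p =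
        (∏ ν, ∏ i, Real.Gamma (b ν i)) * gammaTilt γ b₀ (fun ν => b₀ ν + ∑ i, b ν i) u := by
    intro u hu
    rw [← prod_dirichletConst]
    exact integral_dirichletKernel
      (fun ν => add_pos (hb₀ ν) (mul_pos (hγ ν) hu)) hb
  have hmeas : Measurable (Function.uncurry fun (p : Param m) (u : ℝ) =>
      u ^ (α - 1) * Real.exp (-β * u) * dirichletKernel (fun ν => b₀ ν + γ ν * u) b p) := by
    unfold dirichletKernel p₀ Function.uncurry
    fun_prop
  have hintM := integrableOn_tiltMoment hα hβ hγ hb₀ hτ 0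
  rw [integral_integral_swap]
  · unfold tiltMoment
    rw [← integral_const_mul]
    refine setIntegral_congr_fun measurableSet_Ioi fun u hu => ?_
    simp only [integral_const_mul, (hval u hu).2]
    ring
  · rw [integrable_prod_iff' hmeas.aestronglyMeasurable]
    refine ⟨?_, ?_⟩
    · filter_upwards [ae_restrict_mem measurableSet_Ioi] with u hu
      exact (hval u hu).1.const_mul (u ^ (α - 1) * Real.exp (-β * u))
    · refine (hintM.const_mul (∏ ν, ∏ i, Real.Gamma (b ν i))).congr ?_
      filter_upwards [ae_restrict_mem measurableSet_Ioi] with u hu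
      have hu' : (0 : ℝ) < u := hu
      have : ∀ p ∈ paramSpace m, ‖Function.uncurry (fun (p : Param m) (u : ℝ) =>
          u ^ (α - 1) * Real.exp (-β * u) * dirichletKernel (fun ν => b₀ ν + γ ν * u) b p) (p, u)‖ =
          u ^ (α - 1) * Real.exp (-β * u) * dirichletKernel (fun ν => b₀ ν + γ ν * u) b p := by
        intro p hp
        have := dirichletKernel_pos (fun ν => b₀ ν + γ ν * u) b hp
        refine Real.norm_of_nonneg ?_
        simp only [Function.uncurry_apply_pair]
        positivity
      rw [setIntegral_congr_fun measurableSet_paramSpace this, integral_const_mul, (hval u hu).2]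
      ring

theorem integral_probMonomial_shrinkagePrior (hα : 0 < α) (hβ : 0 < β) (hγ : ∀ ν, 0 < γ ν)
    (ha : ∀ ν i, 0 < a ν i) (hra : ∀ ν, 0 < r ν + a₀ ν)
    (x : Obs m) (c₀ : Fin N → ℕ) (c : ∀ ν, Fin (m ν) → ℕ) :
    ∫ p in paramSpace m, probMonomial c₀ c p *
        (negMultinomialMass r p x * shrinkagePrior α β γ a₀ a p) =
      obsCoeff r x * ((∏ ν, ∏ i, Real.Gamma (x ν i + a ν i + c ν i)) *
        tiltMoment α β γ (fun ν => r ν + a₀ ν + c₀ ν)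
          (fun ν => r ν + a₀ ν + c₀ ν + ∑ i, (x ν i + a ν i + c ν i)) 0) := by
  rw [← integral_integral_dirichletKernel hα hβ hγ
    (fun ν => add_pos_of_pos_of_nonneg (hra ν) (by positivity))
    (fun ν i => by have := ha ν i; positivity), ← integral_const_mul]
  refine setIntegral_congr_fun measurableSet_paramSpace fun p hp => ?_
  simp only [shrinkagePrior]
  rw [← integral_const_mul, ← integral_const_mul, ← integral_const_mul]
  congr 1
  funext u
  have := probMonomial_mul_dirichletKernel r x c₀ c (fun ν => γ ν * u + a₀ ν) a hp
  have e : (fun ν => r ν + (γ ν * u + a₀ ν) + (c₀ ν : ℝ)) =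
      fun ν => r ν + a₀ ν + c₀ ν + γ ν * u := by
    funext ν
    ring
  rw [e] at this
  calc _ = u ^ (α - 1) * Real.exp (-β * u) * (probMonomial c₀ c p *
        (negMultinomialMass r p x * dirichletKernel (fun ν => γ ν * u + a₀ ν) a p)) := by
        unfold dirichletKernel
        ring
    _ = _ := by
        rw [this]
        ring

end

end MultinomialPrediction

namespace MultinomialPrediction

section

variable {N L : ℕ} {m : Fin N → ℕ} {d : Fin L → ℕ} {nu : ∀ t : Fin L, Fin (d t) → Fin N}
  {l : Fin L → ℕ}

/-! ### The probability generating polynomial of the zero counts -/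

instance fintypeSumEq {κ : Type*} [Fintype κ] [DecidableEq κ] (k : ℕ) :
    Fintype {w : κ → ℕ // ∑ i, w i = k} :=
  Fintype.subtype (Finset.piAntidiag Finset.univ k) (by simp)

/-- The generating polynomial `p₀ z + (1 - p₀)` of one draw from the `ν`-th probability vector. -/
noncomputable def drawPoly (p : Param m) (ν : Fin N) : MvPolynomial (Fin N) ℝ :=
  MvPolynomial.C (p₀ p ν) * MvPolynomial.X ν + MvPolynomial.C (1 - p₀ p ν)

/-- The multinomial theorem in a general algebra, because it is applied in the polynomial ring whose
variables mark outcomes in category 0. -/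
theorem sum_multinomial_mul_prod_pow {κ R : Type*} [Fintype κ] [DecidableEq κ] [CommRing R]
    [Algebra ℝ R] (k : ℕ) (q : κ → R) :
    ∑ w : {w : κ → ℕ // ∑ i, w i = k},
      algebraMap ℝ R ((k ! : ℝ) / ∏ i, ((w.1 i)! : ℝ)) * ∏ i, q i ^ w.1 i = (∑ i, q i) ^ k := by
  rw [Finset.sum_pow_eq_sum_piAntidiag]
  rw [Finset.sum_subtype (p := fun w : κ → ℕ => ∑ i, w i = k) (Finset.piAntidiag Finset.univ k)
    (by simp)]
  refine Finset.sum_congr rfl fun w _ => ?_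
  congr 1
  rw [← map_natCast (algebraMap ℝ R)]
  congr 1
  have h := Nat.multinomial_spec Finset.univ w.1
  rw [w.2] at h
  have h0 : (∏ i, ((w.1 i)! : ℝ)) ≠ 0 := by positivity
  rw [div_eq_iff h0, ← h]
  push_cast
  ring

theorem sum_cell_eq (p : Param m) (t : Fin L) :
    ∑ i : Cell m nu t, (MvPolynomial.C (∏ h, fullProb p (nu t h) (i h)) *
      ∏ ν, (MvPolynomial.X ν : MvPolynomial (Fin N) ℝ) ^ cellMult i ν 0) =
      ∏ h, drawPoly p (nu t h) := by
  have hcell : ∀ i : Cell m nu t, ∏ ν, (MvPolynomial.X ν : MvPolynomial (Fin N) ℝ) ^ cellMult i ν 0 =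
      ∏ h, if i h = 0 then MvPolynomial.X (nu t h) else 1 := by
    intro i
    simp only [cellMult, ← Finset.prod_pow_eq_pow_sum]
    rw [Finset.prod_comm]
    refine Finset.prod_congr rfl fun h _ => ?_
    rw [Finset.prod_eq_single (nu t h)]
    · by_cases h0 : i h = 0 <;> simp [h0]
    · intro ν _ hν
      simp [hν.symm]
    · simp
  have hdraw : ∀ h, drawPoly p (nu t h) = ∑ k : Fin (m (nu t h) + 1),
      MvPolynomial.C (fullProb p (nu t h) k) *
        (if k = 0 then MvPolynomial.X (nu t h) else 1) := by
    intro h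
    rw [Fin.sum_univ_succ]
    simp [drawPoly, fullProb, p₀, Fin.succ_ne_zero]
  simp only [hcell, hdraw]
  rw [Finset.prod_univ_sum, Fintype.piFinset_univ]
  refine Finset.sum_congr rfl fun i _ => ?_
  rw [map_prod, ← Finset.prod_mul_distrib]

theorem prod_drawPoly_eq (hnu : ∀ t, StrictMono (nu t)) (p : Param m) :
    ∏ t, (∏ h, drawPoly p (nu t h)) ^ l t = ∏ ν, drawPoly p ν ^ totalCount nu l ν := by
  classical
  have : ∀ t, (∏ h, drawPoly p (nu t h)) ^ l t =
      ∏ ν, drawPoly p ν ^ (if ∃ h, nu t h = ν then l t else 0) := by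
    intro t
    have himg : ∏ h, drawPoly p (nu t h) = ∏ ν ∈ Finset.univ.image (nu t), drawPoly p ν :=
      (Finset.prod_image fun _ _ _ _ h => (hnu t).injective h).symm
    rw [himg, ← Finset.prod_pow, ← Finset.prod_subset (Finset.subset_univ (Finset.univ.image (nu t)))]
    · refine Finset.prod_congr rfl fun ν hν => ?_
      rw [if_pos (by simpa using hν)]
    · intro ν _ hν
      rw [if_neg (by simpa using hν), pow_zero]
  rw [Finset.prod_congr rfl fun t _ => this t, Finset.prod_comm]
  refine Finset.prod_congr rfl fun ν _ => ?_
  rw [Finset.prod_pow_eq_pow_sum, totalCount, Finset.sum_filter]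

/-- The joint generating polynomial of the category-0 counts is a product of binomial ones: however
the tables share the vectors, these counts behave like `T_ν` independent draws from each `ν`. -/
theorem sum_tableMass_mul_prod_X (hnu : ∀ t, StrictMono (nu t)) (p : Param m) :
    ∑ w : Tables m nu l, MvPolynomial.C (tableMass p w) *
      ∏ ν, (MvPolynomial.X ν : MvPolynomial (Fin N) ℝ) ^ categoryCount w ν 0 =
      ∏ ν, drawPoly p ν ^ totalCount nu l ν := by
  rw [← prod_drawPoly_eq hnu]
  simp only [← sum_cell_eq, ← sum_multinomial_mul_prod_pow]
  rw [Finset.prod_univ_sum, Fintype.piFinset_univ]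
  refine Finset.sum_congr rfl fun w _ => ?_
  have hX : ∏ ν, (MvPolynomial.X ν : MvPolynomial (Fin N) ℝ) ^ categoryCount w ν 0 =
      ∏ t, ∏ i : Cell m nu t, (∏ ν, MvPolynomial.X ν ^ cellMult i ν 0) ^ (w t).1 i := by
    simp only [categoryCount, ← Finset.prod_pow_eq_pow_sum, pow_mul, ← Finset.prod_pow]
    rw [Finset.prod_comm]
    refine Finset.prod_congr rfl fun t _ => ?_
    rw [Finset.prod_comm]
  rw [hX, tableMass, map_prod, ← Finset.prod_mul_distrib]
  refine Finset.prod_congr rfl fun t _ => ?_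
  simp only [mul_pow, Finset.prod_mul_distrib, map_mul, map_prod, map_pow,
    MvPolynomial.algebraMap_eq, mul_assoc]

/-! ### Sequential comparison along the draws -/

/-- The linear functional sending the monomial `z ^ c` to `V c`. -/
noncomputable def monomialFunctional (V : (Fin N → ℕ) → ℝ) : MvPolynomial (Fin N) ℝ →ₗ[ℝ] ℝ :=
  (MvPolynomial.basisMonomials (Fin N) ℝ).constr ℝ fun c => V c

theorem monomialFunctional_monomial (V : (Fin N → ℕ) → ℝ) (c : Fin N →₀ ℕ) (x : ℝ) :
    monomialFunctional V (MvPolynomial.monomial c x) = x * V c := by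
  have h := (MvPolynomial.basisMonomials (Fin N) ℝ).constr_basis ℝ (fun c => V c) c
  rw [MvPolynomial.coe_basisMonomials] at h
  have e : MvPolynomial.monomial c x = x • MvPolynomial.monomial c (1 : ℝ) := by
    rw [MvPolynomial.smul_monomial, smul_eq_mul, mul_one]
  rw [e, map_smul, smul_eq_mul]
  exact congrArg _ h

theorem monomialFunctional_C_mul_prod_X (V : (Fin N → ℕ) → ℝ) (c : Fin N → ℕ) (x : ℝ) :
    monomialFunctional V (MvPolynomial.C x * ∏ ν, MvPolynomial.X ν ^ c ν) = x * V c := by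
  have h : MvPolynomial.C x * ∏ ν, (MvPolynomial.X ν : MvPolynomial (Fin N) ℝ) ^ c ν =
      MvPolynomial.monomial (Finsupp.equivFunOnFinite.symm c) x := by
    rw [MvPolynomial.monomial_eq, Finsupp.prod_fintype _ _ fun _ => pow_zero _]
    rfl
  rw [h, monomialFunctional_monomial]
  rfl

theorem drawPoly_coeff_nonneg {p : Param m} (hp : p ∈ paramSpace m) (ν : Fin N) (c : Fin N →₀ ℕ) :
    0 ≤ (drawPoly p ν).coeff c := by
  have h0 := (p₀_pos hp ν).le
  have h1 : 0 ≤ 1 - p₀ p ν := by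
    rw [p₀, sub_sub_cancel]
    exact Finset.sum_nonneg fun i _ => ((hp ν).1 i).le
  rw [drawPoly, MvPolynomial.coeff_add, MvPolynomial.coeff_C_mul, MvPolynomial.coeff_X,
    MvPolynomial.coeff_C]
  split_ifs <;> simp [h0, h1]

theorem coeff_mul_nonneg {P Q : MvPolynomial (Fin N) ℝ} (hP : ∀ c, 0 ≤ P.coeff c)
    (hQ : ∀ c, 0 ≤ Q.coeff c) (c : Fin N →₀ ℕ) : 0 ≤ (P * Q).coeff c := by
  classical
  rw [MvPolynomial.coeff_mul]
  exact Finset.sum_nonneg fun x _ => mul_nonneg (hP _) (hQ _)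

theorem prod_drawPoly_coeff_nonneg {p : Param m} (hp : p ∈ paramSpace m) (n : Fin N → ℕ)
    (c : Fin N →₀ ℕ) : 0 ≤ (∏ ν, drawPoly p ν ^ n ν).coeff c := by
  classical
  have hone : ∀ c, 0 ≤ (1 : MvPolynomial (Fin N) ℝ).coeff c := fun c => by
    rw [MvPolynomial.coeff_one]
    split_ifs <;> norm_num
  refine Finset.prod_induction (fun ν => drawPoly p ν ^ n ν) (fun P => ∀ c, 0 ≤ P.coeff c)
    (fun P Q => coeff_mul_nonneg) hone (fun ν _ => ?_) c
  induction n ν with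
  | zero => simpa using hone
  | succ k ih =>
    rw [pow_succ]
    exact coeff_mul_nonneg ih (drawPoly_coeff_nonneg hp ν)

theorem degreeOf_drawPoly_le (p : Param m) (ν μ : Fin N) :
    (drawPoly p ν).degreeOf μ ≤ if ν = μ then 1 else 0 := by
  refine (MvPolynomial.degreeOf_add_le _ _ _).trans (max_le ?_ ?_)
  · refine (MvPolynomial.degreeOf_C_mul_le _ _ _).trans ?_
    rw [MvPolynomial.degreeOf_X]
    simp only [eq_comm, le_refl]
  · rw [MvPolynomial.degreeOf_C]
    exact Nat.zero_le _

/-- Supplies the side condition `c ≤ n` under which the one-draw inequality is available. -/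
theorem le_of_mem_support_prod_drawPoly (p : Param m) (n : Fin N → ℕ) {c : Fin N →₀ ℕ}
    (hc : c ∈ (∏ ν, drawPoly p ν ^ n ν).support) : ⇑c ≤ n := by
  intro μ
  have h1 : c μ ≤ (∏ ν, drawPoly p ν ^ n ν).degreeOf μ := by
    rw [MvPolynomial.degreeOf_eq_sup]
    exact Finset.le_sup (f := fun c : Fin N →₀ ℕ => c μ) hc
  refine h1.trans ((MvPolynomial.degreeOf_prod_le _ _ _).trans ?_)
  refine (Finset.sum_le_sum fun ν _ => (MvPolynomial.degreeOf_pow_le μ (drawPoly p ν) (n ν)).trans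
    (Nat.mul_le_mul_left _ (degreeOf_drawPoly_le p ν μ))).trans ?_
  simp

/-- A generating polynomial equals `1` at `z = 1`. Nonvanishing gives the nonempty support needed
for strictness. -/
theorem prod_drawPoly_ne_zero (p : Param m) (n : Fin N → ℕ) :
    (∏ ν, drawPoly p ν ^ n ν) ≠ 0 := by
  intro h
  have := congrArg (MvPolynomial.eval fun _ => (1 : ℝ)) h
  simp [drawPoly, map_prod] at this

theorem monomialFunctional_mul_drawPoly (V : (Fin N → ℕ) → ℝ) (P : MvPolynomial (Fin N) ℝ)
    (p : Param m) (ν : Fin N) :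
    monomialFunctional V (P * drawPoly p ν) = ∑ c ∈ P.support, P.coeff c *
      (p₀ p ν * V (⇑c + Pi.single ν 1) + (1 - p₀ p ν) * V c) := by
  classical
  conv_lhs => rw [P.as_sum, Finset.sum_mul, map_sum]
  refine Finset.sum_congr rfl fun c _ => ?_
  have e : MvPolynomial.monomial c (P.coeff c) * drawPoly p ν =
      MvPolynomial.monomial (c + Finsupp.single ν 1) (P.coeff c * p₀ p ν) +
      MvPolynomial.monomial c (P.coeff c * (1 - p₀ p ν)) := by
    rw [drawPoly, mul_add, MvPolynomial.C_mul_X_eq_monomial, MvPolynomial.monomial_mul,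
      mul_comm _ (MvPolynomial.C _), MvPolynomial.C_mul_monomial, mul_comm (1 - p₀ p ν)]
  rw [e, map_add, monomialFunctional_monomial, monomialFunctional_monomial, Finsupp.coe_add,
    Finsupp.single_eq_pi_single]
  ring

theorem prod_drawPoly_add_single (p : Param m) (n : Fin N → ℕ) (ν : Fin N) :
    ∏ μ, drawPoly p μ ^ (n + Pi.single ν 1 : Fin N → ℕ) μ =
      (∏ μ, drawPoly p μ ^ n μ) * drawPoly p ν := by
  simp only [Pi.add_apply, pow_add, Finset.prod_mul_distrib]
  congr 1
  rw [Finset.prod_eq_single ν]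
  · simp
  · intro μ _ hμ
    simp [hμ]
  · simp

/-- The functional applied to the generating polynomial is the mean of `V c n` over random counts
`c`. Removing one draw and averaging `hV` over the counts of the rest gives an induction on the
number of draws. -/
theorem lt_monomialFunctional_prod_drawPoly {p : Param m} (hp : p ∈ paramSpace m)
    {T : Fin N → ℕ} {V : (Fin N → ℕ) → (Fin N → ℕ) → ℝ}
    (hV : ∀ c n ν, c ≤ n → n ν < T ν →
      V c n < p₀ p ν * V (c + Pi.single ν 1) (n + Pi.single ν 1) +
        (1 - p₀ p ν) * V c (n + Pi.single ν 1)) {n : Fin N → ℕ} (hn : n ≤ T) (hn0 : n ≠ 0) :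
    V 0 0 < monomialFunctional (fun c => V c n) (∏ ν, drawPoly p ν ^ n ν) := by
  -- The weak inequality is carried along because it is all that holds at `n = 0`.
  suffices H : ∀ (k : ℕ) (n : Fin N → ℕ), ∑ ν, n ν = k → n ≤ T →
      V 0 0 ≤ monomialFunctional (fun c => V c n) (∏ ν, drawPoly p ν ^ n ν) ∧
      (n ≠ 0 → V 0 0 < monomialFunctional (fun c => V c n) (∏ ν, drawPoly p ν ^ n ν)) from
    (H _ n rfl hn).2 hn0
  intro k
  induction k with
  | zero =>
    intro n hk _
    have h0 : n = 0 := by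
      funext ν
      exact (Finset.sum_eq_zero_iff.1 hk) ν (Finset.mem_univ ν)
    subst h0
    refine ⟨?_, fun h => absurd rfl h⟩
    have h1 : monomialFunctional (fun c => V c 0) (MvPolynomial.monomial 0 1) =
        1 * V (0 : Fin N →₀ ℕ) 0 := monomialFunctional_monomial _ _ _
    rw [one_mul, Finsupp.coe_zero] at h1
    simp only [Pi.zero_apply, pow_zero, Finset.prod_const_one]
    exact h1.ge
  | succ k ih =>
    intro n hk hn
    obtain ⟨ν, hν⟩ : ∃ ν, n ν ≠ 0 := by
      by_contra hcon
      push Not at hcon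
      simp [hcon] at hk
    obtain ⟨n', rfl⟩ : ∃ n' : Fin N → ℕ, n = n' + Pi.single ν 1 := by
      refine ⟨n - Pi.single ν 1, ?_⟩
      funext μ
      rcases eq_or_ne μ ν with rfl | hμ
      · simp only [Pi.add_apply, Pi.sub_apply, Pi.single_eq_same]
        omega
      · simp [hμ]
    have hk' : ∑ μ, n' μ = k := by
      simp only [Pi.add_apply, Finset.sum_add_distrib, Finset.sum_pi_single', Finset.mem_univ,
        if_true] at hk
      omega
    have hn' : n' ≤ T := fun μ => le_trans (by simp) (hn μ)
    have hlt : n' ν < T ν := by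
      have := hn ν
      simp only [Pi.add_apply, Pi.single_eq_same] at this
      omega
    have hle := (ih n' hk' hn').1
    have key : V 0 0 < monomialFunctional (fun c => V c (n' + Pi.single ν 1))
        (∏ μ, drawPoly p μ ^ (n' + Pi.single ν 1 : Fin N → ℕ) μ) := by
      refine hle.trans_lt ?_
      rw [prod_drawPoly_add_single, monomialFunctional_mul_drawPoly]
      set P := ∏ μ, drawPoly p μ ^ n' μ with hP
      conv_lhs => rw [P.as_sum, map_sum]
      refine Finset.sum_lt_sum_of_nonempty
        (MvPolynomial.support_nonempty.2 (prod_drawPoly_ne_zero p n')) fun c hc => ?_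
      rw [monomialFunctional_monomial]
      exact mul_lt_mul_of_pos_left (hV c n' ν (le_of_mem_support_prod_drawPoly p n' hc) hlt)
        (lt_of_le_of_ne (prod_drawPoly_coeff_nonneg hp n' c)
          (Ne.symm (MvPolynomial.mem_support_iff.1 hc)))
    exact ⟨key.le, fun _ => key⟩

end

end MultinomialPrediction

namespace MultinomialPrediction

section

variable {N L : ℕ} {m : Fin N → ℕ} {d : Fin L → ℕ} {nu : ∀ t : Fin L, Fin (d t) → Fin N}
  {l : Fin L → ℕ} {r a₀ : Fin N → ℝ} {a : ∀ ν : Fin N, Fin (m ν) → ℝ}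
  {α β : ℝ} {γ s A : Fin N → ℝ}

/-! ### The logarithm of the ratio of the predictive masses -/

/-- The marginal totals of an observation. -/
def obsTotal (x : Obs m) (ν : Fin N) : ℕ := ∑ i, x ν i

/-- The logarithm of the ratio of the posterior normalizing constants of the shrinkage prior and of
the Dirichlet prior, for totals `y` and `n` further draws among which `c` fell into category `0`. -/
noncomputable def logTiltRatio (α β : ℝ) (γ s A : Fin N → ℝ) (c n y : Fin N → ℕ) : ℝ :=
  Real.log (tiltMoment α β γ (fun ν => s ν + c ν) (fun ν => s ν + A ν + y ν + n ν) 0) -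
    ∑ ν, (Real.log (Real.Gamma (s ν + c ν)) - Real.log (Real.Gamma (s ν + A ν + y ν + n ν)))

theorem posterior_rate_eq {x : Obs m} {c₀ n : Fin N → ℕ} {c : ∀ ν, Fin (m ν) → ℕ}
    (hc : ∀ ν, c₀ ν + ∑ j, c ν j = n ν) (ν : Fin N) :
    r ν + a₀ ν + c₀ ν + ∑ i, ((x ν i : ℝ) + a ν i + c ν i) =
      r ν + a₀ ν + ∑ i, a ν i + obsTotal x ν + n ν := by
  rw [← hc ν, obsTotal, Finset.sum_add_distrib, Finset.sum_add_distrib]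
  push_cast
  ring

theorem log_posterior_dirichletPrior (hr : ∀ ν, 0 < r ν) (ha : ∀ ν i, 0 < a ν i)
    (hra : ∀ ν, 0 < r ν + a₀ ν) {x : Obs m} {c₀ n : Fin N → ℕ} {c : ∀ ν, Fin (m ν) → ℕ}
    (hc : ∀ ν, c₀ ν + ∑ j, c ν j = n ν) :
    0 < ∫ p in paramSpace m, probMonomial c₀ c p *
        (negMultinomialMass r p x * dirichletPrior a₀ a p) ∧
    Real.log (∫ p in paramSpace m, probMonomial c₀ c p *
        (negMultinomialMass r p x * dirichletPrior a₀ a p)) =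
      Real.log (obsCoeff r x) + (∑ ν, ∑ i, Real.log (Real.Gamma (x ν i + a ν i + c ν i)) +
        ∑ ν, (Real.log (Real.Gamma (r ν + a₀ ν + c₀ ν)) -
          Real.log (Real.Gamma (r ν + a₀ ν + ∑ i, a ν i + obsTotal x ν + n ν)))) := by
  have hb₀ : ∀ ν, 0 < r ν + a₀ ν + c₀ ν := fun ν =>
    add_pos_of_pos_of_nonneg (hra ν) (Nat.cast_nonneg _)
  have hb : ∀ ν i, 0 < (x ν i : ℝ) + a ν i + c ν i := fun ν i => by have := ha ν i; positivity
  have hD : ∀ ν, 0 < dirichletConst (r ν + a₀ ν + c₀ ν) fun i => (x ν i : ℝ) + a ν i + c ν i :=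
    fun ν => dirichletConst_pos (hb₀ ν) (hb ν)
  have hO := obsCoeff_pos hr x
  rw [integral_probMonomial_dirichletPrior ha hra]
  refine ⟨mul_pos hO (Finset.prod_pos fun ν _ => hD ν), ?_⟩
  rw [Real.log_mul hO.ne' (Finset.prod_pos fun ν _ => hD ν).ne', Real.log_prod fun ν _ => (hD ν).ne',
    ← Finset.sum_add_distrib]
  congr 1
  refine Finset.sum_congr rfl fun ν _ => ?_
  have h1 := Real.Gamma_pos_of_pos (hb₀ ν)
  have h2 : ∀ i, 0 < Real.Gamma ((x ν i : ℝ) + a ν i + c ν i) := fun i =>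
    Real.Gamma_pos_of_pos (hb ν i)
  have h3 : 0 < Real.Gamma (r ν + a₀ ν + c₀ ν + ∑ i, ((x ν i : ℝ) + a ν i + c ν i)) :=
    Real.Gamma_pos_of_pos (add_pos_of_pos_of_nonneg (hb₀ ν)
      (Finset.sum_nonneg fun i _ => (hb ν i).le))
  rw [dirichletConst, Real.log_div (mul_pos h1 (Finset.prod_pos fun i _ => h2 i)).ne' h3.ne',
    Real.log_mul h1.ne' (Finset.prod_pos fun i _ => h2 i).ne',
    Real.log_prod fun i _ => (h2 i).ne', posterior_rate_eq hc]
  ring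

/-- The coefficient of the observation and the factors `Γ(x + a + c)` are common to both priors;
only the tilted part differs. -/
theorem log_posterior_shrinkagePrior (hα : 0 < α) (hβ : 0 < β) (hγ : ∀ ν, 0 < γ ν)
    (hr : ∀ ν, 0 < r ν) (ha : ∀ ν i, 0 < a ν i)
    (hra : ∀ ν, 0 < r ν + a₀ ν) {x : Obs m} {c₀ n : Fin N → ℕ} {c : ∀ ν, Fin (m ν) → ℕ}
    (hc : ∀ ν, c₀ ν + ∑ j, c ν j = n ν) :
    0 < ∫ p in paramSpace m, probMonomial c₀ c p *
        (negMultinomialMass r p x * shrinkagePrior α β γ a₀ a p) ∧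
    Real.log (∫ p in paramSpace m, probMonomial c₀ c p *
        (negMultinomialMass r p x * shrinkagePrior α β γ a₀ a p)) =
      Real.log (∫ p in paramSpace m, probMonomial c₀ c p *
        (negMultinomialMass r p x * dirichletPrior a₀ a p)) +
      logTiltRatio α β γ (fun ν => r ν + a₀ ν) (fun ν => ∑ i, a ν i) c₀ n (obsTotal x) := by
  have hb₀ : ∀ ν, 0 < r ν + a₀ ν + c₀ ν := fun ν =>
    add_pos_of_pos_of_nonneg (hra ν) (Nat.cast_nonneg _)
  have hb : ∀ ν i, 0 < (x ν i : ℝ) + a ν i + c ν i := fun ν i => by have := ha ν i; positivity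
  have h2 : ∀ ν i, 0 < Real.Gamma ((x ν i : ℝ) + a ν i + c ν i) := fun ν i =>
    Real.Gamma_pos_of_pos (hb ν i)
  have hO := obsCoeff_pos hr x
  have hP : 0 < ∏ ν, ∏ i, Real.Gamma ((x ν i : ℝ) + a ν i + c ν i) :=
    Finset.prod_pos fun ν _ => Finset.prod_pos fun i _ => h2 ν i
  have hM := tiltMoment_pos hα hβ hγ hb₀ (τ := fun ν =>
      r ν + a₀ ν + c₀ ν + ∑ i, ((x ν i : ℝ) + a ν i + c ν i))
    (fun ν => le_add_of_nonneg_right (Finset.sum_nonneg fun i _ => (hb ν i).le)) 0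
  rw [integral_probMonomial_shrinkagePrior hα hβ hγ ha hra]
  refine ⟨by positivity, ?_⟩
  rw [(log_posterior_dirichletPrior hr ha hra hc).2, Real.log_mul hO.ne' (by positivity),
    Real.log_mul hP.ne' hM.ne', Real.log_prod fun ν _ =>
      (Finset.prod_pos fun i _ => h2 ν i).ne',
    Finset.sum_congr rfl fun ν _ => Real.log_prod fun i _ => (h2 ν i).ne', logTiltRatio,
    funext fun ν => posterior_rate_eq (r := r) (a₀ := a₀) (a := a) (x := x) hc ν]
  ring

/-- The denominator is written with the trivial monomial, so the posterior formulas serve it too,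
with all counts zero. -/
theorem bayesPredictive_eq (π : Param m → ℝ) (w : Tables m nu l) (x : Obs m) :
    bayesPredictive r π w x = tableCoeff w *
      (∫ p in paramSpace m, probMonomial (fun ν => categoryCount w ν 0)
        (fun ν j => categoryCount w ν (j + 1)) p * (negMultinomialMass r p x * π p)) /
      ∫ p in paramSpace m, probMonomial 0 (fun _ _ => 0) p * (negMultinomialMass r p x * π p) := by
  unfold bayesPredictive
  simp only [probMonomial_zero, one_mul, tableMass_eq, mul_assoc]
  rw [integral_const_mul]

theorem log_bayesPredictive_dirichletPrior (hnu : ∀ t, StrictMono (nu t)) (hr : ∀ ν, 0 < r ν)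
    (ha : ∀ ν i, 0 < a ν i) (hra : ∀ ν, 0 < r ν + a₀ ν) (w : Tables m nu l) (x : Obs m) :
    0 < bayesPredictive r (dirichletPrior a₀ a) w x ∧
    Real.log (bayesPredictive r (dirichletPrior a₀ a) w x) = Real.log (tableCoeff w) +
      ∑ ν, ((∑ i, (Real.log (Real.Gamma (x ν i + a ν i + categoryCount w ν (i + 1))) -
          Real.log (Real.Gamma (x ν i + a ν i)))) +
        (Real.log (Real.Gamma (r ν + a₀ ν + categoryCount w ν 0)) -
          Real.log (Real.Gamma (r ν + a₀ ν))) -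
        (Real.log (Real.Gamma (r ν + a₀ ν + ∑ i, a ν i + obsTotal x ν + totalCount nu l ν)) -
          Real.log (Real.Gamma (r ν + a₀ ν + ∑ i, a ν i + obsTotal x ν)))) := by
  obtain ⟨p1, e1⟩ := log_posterior_dirichletPrior hr ha hra (x := x) (sum_categoryCount hnu w)
  obtain ⟨p0, e0⟩ := log_posterior_dirichletPrior hr ha hra (x := x) (c₀ := 0) (n := 0)
    (c := fun _ _ => 0) (by simp)
  have hT := tableCoeff_pos w
  rw [bayesPredictive_eq]
  refine ⟨by positivity, ?_⟩
  rw [Real.log_div (by positivity) p0.ne', Real.log_mul hT.ne' p1.ne', e1, e0]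
  simp only [Finset.sum_add_distrib, Finset.sum_sub_distrib, Pi.zero_apply, Nat.cast_zero,
    add_zero]
  ring

theorem log_bayesPredictive_shrinkagePrior (hα : 0 < α) (hβ : 0 < β) (hγ : ∀ ν, 0 < γ ν)
    (hnu : ∀ t, StrictMono (nu t)) (hr : ∀ ν, 0 < r ν)
    (ha : ∀ ν i, 0 < a ν i) (hra : ∀ ν, 0 < r ν + a₀ ν) (w : Tables m nu l) (x : Obs m) :
    0 < bayesPredictive r (shrinkagePrior α β γ a₀ a) w x ∧
    Real.log (bayesPredictive r (shrinkagePrior α β γ a₀ a) w x) =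
      Real.log (bayesPredictive r (dirichletPrior a₀ a) w x) +
      (logTiltRatio α β γ (fun ν => r ν + a₀ ν) (fun ν => ∑ i, a ν i)
        (fun ν => categoryCount w ν 0) (totalCount nu l) (obsTotal x) -
      logTiltRatio α β γ (fun ν => r ν + a₀ ν) (fun ν => ∑ i, a ν i) 0 0 (obsTotal x)) := by
  have hz : ∀ ν : Fin N, (0 : Fin N → ℕ) ν + ∑ _j : Fin (m ν), 0 = (0 : Fin N → ℕ) ν := by simp
  obtain ⟨p1, -⟩ := log_posterior_dirichletPrior hr ha hra (x := x) (sum_categoryCount hnu w)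
  obtain ⟨p0, -⟩ := log_posterior_dirichletPrior hr ha hra (x := x) hz
  obtain ⟨q1, f1⟩ := log_posterior_shrinkagePrior hα hβ hγ hr ha hra (x := x)
    (sum_categoryCount hnu w)
  obtain ⟨q0, f0⟩ := log_posterior_shrinkagePrior hα hβ hγ hr ha hra (x := x) hz
  have hT := tableCoeff_pos w
  rw [bayesPredictive_eq, bayesPredictive_eq]
  refine ⟨by positivity, ?_⟩
  rw [Real.log_div (by positivity) p0.ne', Real.log_mul hT.ne' p1.ne',
    Real.log_div (by positivity) q0.ne', Real.log_mul hT.ne' q1.ne', f1, f0]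
  ring

/-! ### Linear bounds -/

/-- Each unit step adds one logarithm, at most linear from above and controlled from below by `1 /
z₀`. The bound is crude, but linear in `z`. -/
theorem abs_log_Gamma_add_nat_sub_le {z₀ z : ℝ} (h₀ : 0 < z₀) (hz : z₀ ≤ z) (k : ℕ) :
    |Real.log (Real.Gamma (z + k)) - Real.log (Real.Gamma z)| ≤ k * (z + k + 1 / z₀) := by
  have hz0 : 0 < z := h₀.trans_le hz
  induction k with
  | zero => simp
  | succ k ih =>
    have hk : (0 : ℝ) ≤ k := k.cast_nonneg
    have hzk : 0 < z + k := by linarith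
    have hl : |Real.log (z + k)| ≤ z + k + 1 / z₀ := by
      have h1 := Real.log_le_sub_one_of_pos hzk
      have h2 := Real.log_le_sub_one_of_pos (one_div_pos.2 hzk)
      rw [one_div, Real.log_inv, ← one_div] at h2
      have h3 : 1 / (z + k) ≤ 1 / z₀ := one_div_le_one_div_of_le h₀ (by linarith)
      have h4 : 0 < 1 / z₀ := by positivity
      rw [abs_le]
      constructor <;> linarith
    have e : Real.log (Real.Gamma (z + (k + 1 : ℕ))) - Real.log (Real.Gamma z) =
        Real.log (z + k) + (Real.log (Real.Gamma (z + k)) - Real.log (Real.Gamma z)) := by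
      push_cast
      rw [← add_assoc, log_Gamma_add_one hzk]
      ring
    rw [e]
    refine (abs_add_le _ _).trans ?_
    have h4 : 0 < 1 / z₀ := by positivity
    push_cast
    nlinarith

/-- Along the filter `⊤`, `=O` means a bound with one constant at every point, as required for sums
over all observations. -/
theorem isBigO_one_of_linear {X : Type*} {g : X → ℝ} (hg : ∀ x, 0 ≤ g x) (C : ℝ) :
    (fun _ : X => C) =O[⊤] fun x => 1 + g x :=
  Asymptotics.IsBigO.of_bound ‖C‖ (Eventually.of_forall fun x => by
    rw [Real.norm_of_nonneg (by linarith [hg x] : 0 ≤ 1 + g x)]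
    exact le_mul_of_one_le_right (norm_nonneg _) (by linarith [hg x]))

theorem isBigO_total (ν : Fin N) :
    (fun y : Fin N → ℕ => (y ν : ℝ)) =O[⊤] fun y => 1 + ∑ ν, (y ν : ℝ) :=
  Asymptotics.IsBigO.of_bound 1 (Eventually.of_forall fun y => by
    have h1 : (y ν : ℝ) ≤ ∑ ν, (y ν : ℝ) :=
      Finset.single_le_sum (f := fun ν => (y ν : ℝ)) (fun _ _ => Nat.cast_nonneg _)
        (Finset.mem_univ ν)
    have h2 : (0 : ℝ) ≤ y ν := Nat.cast_nonneg _
    rw [Real.norm_of_nonneg h2, Real.norm_of_nonneg (by linarith)]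
    linarith)

theorem isBigO_const_total (C : ℝ) :
    (fun _ : Fin N → ℕ => C) =O[⊤] fun y => 1 + ∑ ν, (y ν : ℝ) :=
  isBigO_one_of_linear (fun _ => Finset.sum_nonneg fun _ _ => Nat.cast_nonneg _) C

theorem isBigO_obsTotal {f : (Fin N → ℕ) → ℝ} (hf : f =O[⊤] fun y => 1 + ∑ ν, (y ν : ℝ)) :
    (fun x : Obs m => f (obsTotal x)) =O[⊤] fun x => 1 + ∑ ν, (obsTotal x ν : ℝ) :=
  hf.comp_tendsto (k := obsTotal) tendsto_top

/-- The tilt decreases in `u`. Bounding it by its value at `0` gives the upper estimate, where the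
Gamma terms cancel exactly. Restricting to `u ≤ 1` and bounding it below by its value at `1` gives
the lower one, where increments of `log Γ` by `γ ν` remain. -/
theorem abs_logTiltRatio_le (hα : 0 < α) (hβ : 0 < β) (hγ : ∀ ν, 0 < γ ν) (hs : ∀ ν, 0 < s ν)
    (hA : ∀ ν, 0 ≤ A ν) {c n : Fin N → ℕ} (hcn : c ≤ n) (y : Fin N → ℕ) :
    |logTiltRatio α β γ s A c n y| ≤
      |Real.log (∫ u in Ioi (0 : ℝ), u ^ (α - 1) * Real.exp (-β * u))| +
      |Real.log (∫ u in Ioc (0 : ℝ) 1, u ^ (α - 1) * Real.exp (-β * u))| +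
      |∑ ν, (Real.log (Real.Gamma (s ν + c ν + γ ν)) - Real.log (Real.Gamma (s ν + c ν)))| +
      ∑ ν, γ ν * (s ν + A ν + y ν + n ν + γ ν) := by
  set σ : Fin N → ℝ := fun ν => s ν + c ν with hσ
  set τ : Fin N → ℝ := fun ν => s ν + A ν + y ν + n ν with hτdef
  have hσ0 : ∀ ν, 0 < σ ν := fun ν => add_pos_of_pos_of_nonneg (hs ν) (Nat.cast_nonneg _)
  have hστ : ∀ ν, σ ν ≤ τ ν := fun ν => by
    have h1 : (c ν : ℝ) ≤ n ν := Nat.cast_le.2 (hcn ν)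
    have h2 := hA ν
    have h3 : (0 : ℝ) ≤ y ν := Nat.cast_nonneg _
    simp only [hσ, hτdef]
    linarith
  have hτ0 : ∀ ν, 0 < τ ν := fun ν => (hσ0 ν).trans_le (hστ ν)
  have hlogtilt : ∀ u : ℝ, 0 ≤ u → Real.log (gammaTilt γ σ τ u) =
      ∑ ν, (Real.log (Real.Gamma (σ ν + γ ν * u)) - Real.log (Real.Gamma (τ ν + γ ν * u))) := by
    intro u hu
    have h1 : ∀ ν, 0 < Real.Gamma (σ ν + γ ν * u) := fun ν => Real.Gamma_pos_of_pos
      (add_pos_of_pos_of_nonneg (hσ0 ν) (mul_nonneg (hγ ν).le hu))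
    have h2 : ∀ ν, 0 < Real.Gamma (τ ν + γ ν * u) := fun ν => Real.Gamma_pos_of_pos
      (add_pos_of_pos_of_nonneg (hτ0 ν) (mul_nonneg (hγ ν).le hu))
    rw [gammaTilt, Real.log_prod fun ν _ => (div_pos (h1 ν) (h2 ν)).ne']
    exact Finset.sum_congr rfl fun ν _ => Real.log_div (h1 ν).ne' (h2 ν).ne'
  have hanti := gammaTilt_antitoneOn hγ hσ0 hστ
  have hM := tiltMoment_pos hα hβ hγ hσ0 hστ 0
  have hint := integrableOn_tiltMoment hα hβ hγ hσ0 hστ 0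
  have hg := integrableOn_gammaDensity hα hβ
  have hg1 : IntegrableOn (fun u : ℝ => u ^ (α - 1) * Real.exp (-β * u)) (Ioc 0 1) :=
    hg.mono_set Ioc_subset_Ioi_self
  have hgpos : ∀ u : ℝ, 0 < u → 0 < u ^ (α - 1) * Real.exp (-β * u) := fun u hu => by positivity
  have hC1 : 0 < ∫ u in Ioc (0 : ℝ) 1, u ^ (α - 1) * Real.exp (-β * u) := by
    rw [setIntegral_pos_iff_support_of_nonneg_ae
      ((ae_restrict_mem measurableSet_Ioc).mono fun u hu => (hgpos u hu.1).le) hg1,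
      inter_eq_self_of_subset_right (show Ioc (0 : ℝ) 1 ⊆ Function.support _ from
        fun u hu => (hgpos u hu.1).ne')]
    simp
  have hC0 : 0 < ∫ u in Ioi (0 : ℝ), u ^ (α - 1) * Real.exp (-β * u) :=
    hC1.trans_le (setIntegral_mono_set hg
      ((ae_restrict_mem measurableSet_Ioi).mono fun u hu => (hgpos u hu).le)
      Ioc_subset_Ioi_self.eventuallyLE)
  have t0 := gammaTilt_pos hγ hσ0 hστ le_rfl
  have t1 := gammaTilt_pos hγ hσ0 hστ zero_le_one
  have hupper : tiltMoment α β γ σ τ 0 ≤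
      (∫ u in Ioi (0 : ℝ), u ^ (α - 1) * Real.exp (-β * u)) * gammaTilt γ σ τ 0 := by
    rw [← integral_mul_const]
    refine setIntegral_mono_on hint (hg.mul_const _) measurableSet_Ioi fun u hu => ?_
    have hu' : (0 : ℝ) ≤ u := le_of_lt hu
    rw [pow_zero, mul_one]
    exact mul_le_mul_of_nonneg_left (hanti self_mem_Ici hu' hu') (hgpos u hu).le
  have hlower : (∫ u in Ioc (0 : ℝ) 1, u ^ (α - 1) * Real.exp (-β * u)) * gammaTilt γ σ τ 1 ≤
      tiltMoment α β γ σ τ 0 := by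
    rw [← integral_mul_const]
    refine le_trans (setIntegral_mono_on (hg1.mul_const _) (hint.mono_set Ioc_subset_Ioi_self)
      measurableSet_Ioc fun u hu => ?_) (setIntegral_mono_set hint
      ((ae_restrict_mem measurableSet_Ioi).mono fun u hu => ?_) Ioc_subset_Ioi_self.eventuallyLE)
    · rw [pow_zero, mul_one]
      exact mul_le_mul_of_nonneg_left (hanti hu.1.le (mem_Ici.2 zero_le_one) hu.2) (hgpos u hu.1).le
    · have h1 := gammaTilt_pos hγ hσ0 hστ (le_of_lt hu)
      have h2 := hgpos u hu
      simp only [Pi.zero_apply, pow_zero, mul_one]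
      positivity
  have lu := Real.log_le_log hM hupper
  have ll := Real.log_le_log (mul_pos hC1 t1) hlower
  rw [Real.log_mul hC0.ne' t0.ne', hlogtilt 0 le_rfl] at lu
  rw [Real.log_mul hC1.ne' t1.ne', hlogtilt 1 zero_le_one] at ll
  simp only [mul_zero, add_zero] at lu
  simp only [mul_one] at ll
  have hgap : ∑ ν, (Real.log (Real.Gamma (τ ν + γ ν)) - Real.log (Real.Gamma (τ ν))) ≤
      ∑ ν, γ ν * (τ ν + γ ν) := by
    refine Finset.sum_le_sum fun ν _ => (log_Gamma_add_sub_le (hτ0 ν) (hγ ν)).trans ?_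
    refine mul_le_mul_of_nonneg_left ?_ (hγ ν).le
    have := Real.log_le_sub_one_of_pos (add_pos (hτ0 ν) (hγ ν))
    linarith
  have hsumnn : 0 ≤ ∑ ν, γ ν * (τ ν + γ ν) := Finset.sum_nonneg fun ν _ =>
    mul_nonneg (hγ ν).le (add_pos (hτ0 ν) (hγ ν)).le
  simp only [Finset.sum_sub_distrib] at lu ll hgap ⊢
  have b1 := le_abs_self (Real.log (∫ u in Ioi (0 : ℝ), u ^ (α - 1) * Real.exp (-β * u)))
  have b2 := neg_abs_le (Real.log (∫ u in Ioc (0 : ℝ) 1, u ^ (α - 1) * Real.exp (-β * u)))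
  have b3 := neg_abs_le (∑ ν, Real.log (Real.Gamma (σ ν + γ ν)) -
    ∑ ν, Real.log (Real.Gamma (σ ν)))
  have n1 := abs_nonneg (Real.log (∫ u in Ioi (0 : ℝ), u ^ (α - 1) * Real.exp (-β * u)))
  have n2 := abs_nonneg (Real.log (∫ u in Ioc (0 : ℝ) 1, u ^ (α - 1) * Real.exp (-β * u)))
  have n3 := abs_nonneg (∑ ν, Real.log (Real.Gamma (σ ν + γ ν)) -
    ∑ ν, Real.log (Real.Gamma (σ ν)))
  have hdef : logTiltRatio α β γ s A c n y = Real.log (tiltMoment α β γ σ τ 0) -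
      (∑ ν, Real.log (Real.Gamma (σ ν)) - ∑ ν, Real.log (Real.Gamma (τ ν))) := by
    rw [logTiltRatio, Finset.sum_sub_distrib]
  rw [hdef, abs_le]
  constructor <;> linarith

theorem isBigO_logTiltRatio (hα : 0 < α) (hβ : 0 < β) (hγ : ∀ ν, 0 < γ ν) (hs : ∀ ν, 0 < s ν)
    (hA : ∀ ν, 0 ≤ A ν) {c n : Fin N → ℕ} (hcn : c ≤ n) :
    logTiltRatio α β γ s A c n =O[⊤] fun y => 1 + ∑ ν, (y ν : ℝ) := by
  refine Asymptotics.IsBigO.trans (Asymptotics.IsBigO.of_norm_le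
    (abs_logTiltRatio_le hα hβ hγ hs hA hcn)) ?_
  refine (isBigO_const_total _).add (Asymptotics.IsBigO.fun_sum fun ν _ => ?_)
  exact (((((isBigO_const_total _).add (isBigO_total ν)).add (isBigO_const_total _)).add
    (isBigO_const_total _)).const_mul_left _)

theorem isBigO_log_bayesPredictive_dirichletPrior (hnu : ∀ t, StrictMono (nu t))
    (hr : ∀ ν, 0 < r ν) (ha : ∀ ν i, 0 < a ν i) (hra : ∀ ν, 0 < r ν + a₀ ν)
    (w : Tables m nu l) :
    (fun x => Real.log (bayesPredictive r (dirichletPrior a₀ a) w x)) =O[⊤]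
      fun x => 1 + ∑ ν, (obsTotal x ν : ℝ) := by
  simp only [fun x => (log_bayesPredictive_dirichletPrior hnu hr ha hra w x).2]
  have hc : ∀ C : ℝ, (fun _ : Obs m => C) =O[⊤] fun x => 1 + ∑ ν, (obsTotal x ν : ℝ) :=
    fun C => isBigO_obsTotal (isBigO_const_total C)
  have ht : ∀ ν, (fun x : Obs m => (obsTotal x ν : ℝ)) =O[⊤]
      fun x => 1 + ∑ ν, (obsTotal x ν : ℝ) := fun ν => isBigO_obsTotal (isBigO_total ν)
  have hx : ∀ ν i, (fun x : Obs m => (x ν i : ℝ)) =O[⊤]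
      fun x => 1 + ∑ ν, (obsTotal x ν : ℝ) := fun ν i => by
    refine Asymptotics.IsBigO.trans (Asymptotics.IsBigO.of_norm_le fun x => ?_) (ht ν)
    rw [Real.norm_of_nonneg (Nat.cast_nonneg _)]
    exact Nat.cast_le.2 (Finset.single_le_sum (f := fun i => x ν i) (fun _ _ => Nat.zero_le _)
      (Finset.mem_univ i))
  refine (hc _).add (Asymptotics.IsBigO.fun_sum fun ν _ => ?_)
  have hA : 0 ≤ ∑ i, a ν i := Finset.sum_nonneg fun i _ => (ha ν i).le
  refine ((Asymptotics.IsBigO.fun_sum fun i _ => ?_).add (hc _)).sub ?_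
  · refine Asymptotics.IsBigO.trans (Asymptotics.IsBigO.of_norm_le fun x =>
      abs_log_Gamma_add_nat_sub_le (ha ν i) (le_add_of_nonneg_left (Nat.cast_nonneg _)) _) ?_
    exact ((((hx ν i).add (hc _)).add (hc _)).add (hc _)).const_mul_left _
  · refine Asymptotics.IsBigO.trans (Asymptotics.IsBigO.of_norm_le fun x =>
      abs_log_Gamma_add_nat_sub_le (hra ν) (by
        have : (0 : ℝ) ≤ obsTotal x ν := Nat.cast_nonneg _
        linarith) _) ?_
    exact ((((hc _).add (ht ν)).add (hc _)).add (hc _)).const_mul_left _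

end

end MultinomialPrediction

namespace MultinomialPrediction

section

/-! ### Summability of the negative multinomial mass function -/

/-- A finite set of index families lies in a finite box, over which the sum of products factors. -/
theorem summable_prod_pi {ι : Type*} [Fintype ι] {κ : ι → Type*} {f : ∀ i, κ i → ℝ}
    (h0 : ∀ i k, 0 ≤ f i k) (hf : ∀ i, Summable (f i)) :
    Summable fun x : ∀ i, κ i => ∏ i, f i (x i) := by
  classical
  refine summable_of_sum_le (c := ∏ i, ∑' k, f i k)
    (fun x => Finset.prod_nonneg fun i _ => h0 i (x i)) fun u => ?_
  refine (Finset.sum_le_sum_of_subset_of_nonneg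
    (t := Fintype.piFinset fun i => u.image fun x => x i) (fun x hx => ?_)
    fun x _ _ => Finset.prod_nonneg fun i _ => h0 i (x i)).trans ?_
  · rw [Fintype.mem_piFinset]
    exact fun i => Finset.mem_image_of_mem _ hx
  · rw [← Finset.prod_univ_sum]
    exact Finset.prod_le_prod (fun i _ => Finset.sum_nonneg fun k _ => h0 i k)
      fun i _ => (hf i).sum_le_tsum _ fun k _ => h0 i k

theorem one_add_sum_le_prod {ι : Type*} (S : Finset ι) {f : ι → ℝ} (hf : ∀ i, 0 ≤ f i) :
    1 + ∑ i ∈ S, f i ≤ ∏ i ∈ S, (1 + f i) := by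
  classical
  induction S using Finset.induction_on with
  | empty => simp
  | insert i S hi ih =>
    rw [Finset.sum_insert hi, Finset.prod_insert hi]
    have h1 := hf i
    have h2 : 0 ≤ ∑ i ∈ S, f i := Finset.sum_nonneg fun i _ => hf i
    nlinarith [mul_le_mul_of_nonneg_left ih (by linarith : 0 ≤ 1 + f i), mul_nonneg h1 h2]

/-- The mass function of a single negative multinomial vector. -/
noncomputable def blockMass {k : ℕ} (ρ q₀ : ℝ) (q : Fin k → ℝ) (x : Fin k → ℕ) : ℝ :=
  Real.Gamma (ρ + ∑ i, (x i : ℝ)) / (Real.Gamma ρ * ∏ i, ((x i)! : ℝ)) * q₀ ^ ρ * ∏ i, q i ^ x i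

/-- Raising `n` by one multiplies the left side by `ρ + n` and the right side by `n + k + 1`. -/
theorem Gamma_add_nat_le {ρ : ℝ} (hρ : 0 < ρ) {k : ℕ} (hk : ρ ≤ k + 1) (n : ℕ) :
    Real.Gamma (ρ + n) ≤ Real.Gamma ρ * (n ! * (n + k).choose k) := by
  induction n with
  | zero => simp
  | succ n ih =>
    have hn : (0 : ℝ) ≤ n := n.cast_nonneg
    have hG := Real.Gamma_pos_of_pos hρ
    have hch : ((n + 1 : ℕ) : ℝ) * ((n + 1 + k).choose k : ℕ) = (n + k + 1) * (n + k).choose k := by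
      have h := Nat.add_one_mul_choose_eq (n + k) n
      have e1 : (n + k).choose n = (n + k).choose k := Nat.choose_symm_add
      have e2 : (n + k + 1).choose (n + 1) = (n + 1 + k).choose k := by
        rw [show n + k + 1 = n + 1 + k by ring]
        exact Nat.choose_symm_add
      rw [e1, e2] at h
      have h' := congrArg (Nat.cast (R := ℝ)) h
      push_cast at h' ⊢
      linarith
    have e : Real.Gamma (ρ + (n + 1 : ℕ)) = (ρ + n) * Real.Gamma (ρ + n) := by
      push_cast
      rw [← add_assoc, Real.Gamma_add_one (by linarith : 0 < ρ + n).ne']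
    rw [e, Nat.factorial_succ, Nat.cast_mul]
    calc (ρ + n) * Real.Gamma (ρ + n)
        ≤ (n + k + 1) * (Real.Gamma ρ * (n ! * (n + k).choose k)) := by
          exact mul_le_mul (by linarith) ih (Real.Gamma_pos_of_pos (by linarith)).le (by positivity)
      _ = Real.Gamma ρ * (n ! * ((n + k + 1) * (n + k).choose k)) := by ring
      _ = _ := by
          rw [← hch]
          ring

theorem multinomial_mul_prod_pow_le {k : ℕ} {q : Fin k → ℝ} (hq : ∀ i, 0 ≤ q i) (x : Fin k → ℕ) :
    ((∑ i, x i)! : ℝ) / (∏ i, ((x i)! : ℝ)) * ∏ i, q i ^ x i ≤ (∑ i, q i) ^ ∑ i, x i := by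
  rw [Finset.sum_pow_eq_sum_piAntidiag]
  refine le_trans (le_of_eq ?_) (Finset.single_le_sum (s := Finset.piAntidiag Finset.univ (∑ i, x i))
    (f := fun w : Fin k → ℕ => (Nat.multinomial Finset.univ w : ℝ) * ∏ i, q i ^ w i)
    (fun w _ => mul_nonneg (Nat.cast_nonneg _) (Finset.prod_nonneg fun i _ => pow_nonneg (hq i) _))
    (a := x) (by simp))
  congr 1
  have h0 : (∏ i, ((x i)! : ℝ)) ≠ 0 := by positivity
  rw [div_eq_iff h0, ← Nat.multinomial_spec Finset.univ x]
  push_cast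
  ring

theorem summable_blockMass {k : ℕ} {ρ q₀ : ℝ} {q : Fin k → ℝ} (hρ : 0 < ρ) (hq₀ : 0 ≤ q₀)
    (hq : ∀ i, 0 ≤ q i) (hq1 : ∑ i, q i < 1) :
    Summable fun x : Fin k → ℕ => blockMass ρ q₀ q x * (1 + ∑ i, (x i : ℝ)) := by
  set Q := ∑ i, q i with hQ
  have hQ0 : 0 ≤ Q := Finset.sum_nonneg fun i _ => hq i
  -- The room between `Q` and `1` lets a geometric sequence with ratio `θ` absorb all factors
  -- polynomial in the total.
  obtain ⟨θ, hθ1, hθ2⟩ := exists_between hq1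
  have hθ0 : 0 < θ := hQ0.trans_lt hθ1
  obtain ⟨j, hj⟩ := exists_nat_ge ρ
  have hratio : ‖Q / θ‖ < 1 := by
    rw [Real.norm_of_nonneg (by positivity), div_lt_one hθ0]
    exact hθ1
  obtain ⟨B, hB⟩ := (summable_choose_mul_geometric_of_norm_lt_one (j + 1)
    hratio).tendsto_atTop_zero.bddAbove_range
  have hB' : ∀ n : ℕ, ((n + (j + 1)).choose (j + 1) : ℝ) * Q ^ n ≤ B * θ ^ n := by
    intro n
    have := hB ⟨n, rfl⟩
    simp only [div_pow] at this
    rw [← mul_div_assoc, div_le_iff₀ (pow_pos hθ0 n)] at this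
    exact this
  have hG := Real.Gamma_pos_of_pos hρ
  have hq₀' : 0 ≤ q₀ ^ ρ := Real.rpow_nonneg hq₀ _
  have hgeo : Summable fun x : Fin k → ℕ => (j + 1) * B * q₀ ^ ρ * ∏ i, θ ^ x i :=
    (summable_prod_pi (f := fun (_ : Fin k) n => θ ^ n) (fun _ _ => pow_nonneg hθ0.le _)
      fun _ => summable_geometric_of_lt_one hθ0.le hθ2).mul_left _
  refine Summable.of_nonneg_of_le (fun x => ?_) (fun x => ?_) hgeo
  · have h1 : 0 < Real.Gamma (ρ + ∑ i, (x i : ℝ)) := Real.Gamma_pos_of_pos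
      (add_pos_of_pos_of_nonneg hρ (Finset.sum_nonneg fun _ _ => Nat.cast_nonneg _))
    have h2 : 0 ≤ ∏ i, q i ^ x i := Finset.prod_nonneg fun i _ => pow_nonneg (hq i) _
    unfold blockMass
    positivity
  · set n := ∑ i, x i with hn
    have hnc : ∑ i, (x i : ℝ) = n := by
      rw [hn]
      push_cast
      rfl
    have hmult := multinomial_mul_prod_pow_le hq x
    rw [← hn, ← hQ] at hmult
    have hΓ := Gamma_add_nat_le hρ (k := j) (by linarith) n
    have h2 : 0 ≤ ∏ i, q i ^ x i := Finset.prod_nonneg fun i _ => pow_nonneg (hq i) _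
    -- The linear weight is absorbed by raising the order of the binomial coefficient, which is why
    -- `B` was chosen for order `j + 1`.
    have hch : ((n : ℝ) + 1) * (n + j).choose j ≤ (j + 1) * (n + (j + 1)).choose (j + 1) := by
      have h := congrArg (Nat.cast (R := ℝ)) (Nat.add_one_mul_choose_eq (n + j) j)
      push_cast at h
      have hj0 : (0 : ℝ) ≤ j * (n + j).choose j := by positivity
      rw [← add_assoc n j 1]
      linarith
    have hP : ∏ i, θ ^ x i = θ ^ n := Finset.prod_pow_eq_pow_sum _ _ _
    rw [hP, blockMass, hnc]
    calc Real.Gamma (ρ + n) / (Real.Gamma ρ * ∏ i, ((x i)! : ℝ)) * q₀ ^ ρ * (∏ i, q i ^ x i) *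
          (1 + n)
        ≤ Real.Gamma ρ * (n ! * (n + j).choose j) / (Real.Gamma ρ * ∏ i, ((x i)! : ℝ)) *
          q₀ ^ ρ * (∏ i, q i ^ x i) * (1 + n) := by gcongr
      _ = ((n : ℝ) + 1) * (n + j).choose j * q₀ ^ ρ *
          ((n ! : ℝ) / (∏ i, ((x i)! : ℝ)) * ∏ i, q i ^ x i) := by
          field_simp
          ring
      _ ≤ ((n : ℝ) + 1) * (n + j).choose j * q₀ ^ ρ * Q ^ n := by gcongr
      _ ≤ (j + 1) * (n + (j + 1)).choose (j + 1) * q₀ ^ ρ * Q ^ n := by gcongr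
      _ = (j + 1) * q₀ ^ ρ * ((n + (j + 1)).choose (j + 1) * Q ^ n) := by ring
      _ ≤ (j + 1) * q₀ ^ ρ * (B * θ ^ n) :=
          mul_le_mul_of_nonneg_left (hB' n) (by positivity)
      _ = _ := by ring

variable {N : ℕ} {m : Fin N → ℕ} {r : Fin N → ℝ} {p : Param m}

theorem negMultinomialMass_eq_prod_blockMass (r : Fin N → ℝ) (p : Param m) (x : Obs m) :
    negMultinomialMass r p x = ∏ ν, blockMass (r ν) (p₀ p ν) (p ν) (x ν) := rfl

theorem summable_negMultinomialMass_mul_linear (hr : ∀ ν, 0 < r ν) (hp : p ∈ paramSpace m) :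
    Summable fun x : Obs m => negMultinomialMass r p x * (1 + ∑ ν, (obsTotal x ν : ℝ)) := by
  have hcast : ∀ (x : Obs m) ν, (obsTotal x ν : ℝ) = ∑ i, (x ν i : ℝ) := fun x ν => by
    rw [obsTotal]
    push_cast
    rfl
  have hsum := summable_prod_pi
    (f := fun ν (x : Fin (m ν) → ℕ) => blockMass (r ν) (p₀ p ν) (p ν) x * (1 + ∑ i, (x i : ℝ)))
    (fun ν x => by
      have h1 : 0 < Real.Gamma (r ν + ∑ i, (x i : ℝ)) := Real.Gamma_pos_of_pos
        (add_pos_of_pos_of_nonneg (hr ν) (Finset.sum_nonneg fun _ _ => Nat.cast_nonneg _))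
      have h2 : 0 ≤ ∏ i, p ν i ^ x i := Finset.prod_nonneg fun i _ => pow_nonneg ((hp ν).1 i).le _
      have h3 := Real.Gamma_pos_of_pos (hr ν)
      have h4 : 0 ≤ p₀ p ν ^ r ν := Real.rpow_nonneg (p₀_pos hp ν).le _
      unfold blockMass
      positivity)
    (fun ν => summable_blockMass (hr ν) (p₀_pos hp ν).le (fun i => ((hp ν).1 i).le) (hp ν).2)
  refine Summable.of_nonneg_of_le (fun x => ?_) (fun x => ?_) hsum
  · have := negMultinomialMass_pos hr hp x
    positivity
  · rw [Finset.prod_mul_distrib, ← negMultinomialMass_eq_prod_blockMass]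
    refine mul_le_mul_of_nonneg_left ?_ (negMultinomialMass_pos hr hp x).le
    simp only [← hcast]
    exact one_add_sum_le_prod _ fun ν => Nat.cast_nonneg _

theorem summable_negMultinomialMass_mul (hr : ∀ ν, 0 < r ν) (hp : p ∈ paramSpace m)
    {f : Obs m → ℝ} (hf : f =O[⊤] fun x => 1 + ∑ ν, (obsTotal x ν : ℝ)) :
    Summable fun x => negMultinomialMass r p x * f x :=
  summable_of_isBigO (summable_negMultinomialMass_mul_linear hr hp)
    (((Asymptotics.isBigO_refl _ _).mul hf).mono le_top)

/-! ### The shift identity of the negative multinomial distribution -/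

/-- Adding one observation of the category `i` of the `ν`-th vector. -/
def addObs (ν : Fin N) (i : Fin (m ν)) (x : Obs m) : Obs m :=
  Function.update x ν (x ν + Pi.single i 1)

theorem addObs_injective (ν : Fin N) (i : Fin (m ν)) : Function.Injective (addObs ν i) := by
  intro x y h
  funext μ
  have hμ := congrFun h μ
  rcases eq_or_ne μ ν with rfl | hne
  · simpa [addObs] using hμ
  · simpa [addObs, hne] using hμ

theorem obsTotal_addObs (ν : Fin N) (i : Fin (m ν)) (x : Obs m) :
    obsTotal (addObs ν i x) = obsTotal x + Pi.single ν 1 := by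
  funext μ
  rcases eq_or_ne μ ν with rfl | hne
  · simp [obsTotal, addObs, Finset.sum_add_distrib]
  · simp [obsTotal, addObs, hne]

theorem blockMass_add_single {k : ℕ} {ρ q₀ : ℝ} {q : Fin k → ℝ} (hρ : 0 < ρ) (x : Fin k → ℕ)
    (i : Fin k) :
    blockMass ρ q₀ q (x + Pi.single i 1) * (x i + 1) =
      blockMass ρ q₀ q x * ((ρ + ∑ i, (x i : ℝ)) * q i) := by
  have hfac : ∏ j, (((x + Pi.single i 1 : Fin k → ℕ) j)! : ℝ) = (∏ j, ((x j)! : ℝ)) * (x i + 1) := by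
    rw [← Finset.mul_prod_erase _ _ (Finset.mem_univ i),
      ← Finset.mul_prod_erase _ (fun j => ((x j)! : ℝ)) (Finset.mem_univ i),
      Finset.prod_congr rfl fun j hj => by
        rw [Pi.add_apply, Pi.single_eq_of_ne (Finset.ne_of_mem_erase hj), add_zero],
      Pi.add_apply, Pi.single_eq_same, Nat.factorial_succ]
    push_cast
    ring
  have hpow : ∏ j, q j ^ (x + Pi.single i 1 : Fin k → ℕ) j = (∏ j, q j ^ x j) * q i := by
    simp only [Pi.add_apply, pow_add, Finset.prod_mul_distrib]
    congr 1
    rw [Finset.prod_eq_single i]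
    · simp
    · intro j _ hj
      simp [hj]
    · simp
  have hsum : ∑ j, ((x + Pi.single i 1 : Fin k → ℕ) j : ℝ) = ∑ j, (x j : ℝ) + 1 := by
    simp only [Pi.add_apply, Nat.cast_add, Finset.sum_add_distrib]
    congr 1
    rw [Finset.sum_eq_single i]
    · simp
    · intro j _ hj
      simp [hj]
    · simp
  have hpos : 0 < ρ + ∑ j, (x j : ℝ) :=
    add_pos_of_pos_of_nonneg hρ (Finset.sum_nonneg fun _ _ => Nat.cast_nonneg _)
  have hG := (Real.Gamma_pos_of_pos hρ).ne'
  unfold blockMass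
  rw [hfac, hpow, hsum, ← add_assoc, Real.Gamma_add_one hpos.ne']
  field_simp

theorem negMultinomialMass_addObs (hr : ∀ ν, 0 < r ν) (p : Param m) (ν : Fin N) (i : Fin (m ν))
    (x : Obs m) :
    negMultinomialMass r p (addObs ν i x) * (x ν i + 1) =
      negMultinomialMass r p x * ((r ν + obsTotal x ν) * p ν i) := by
  have hcast : (obsTotal x ν : ℝ) = ∑ i, (x ν i : ℝ) := by
    rw [obsTotal]
    push_cast
    rfl
  have h := blockMass_add_single (q₀ := p₀ p ν) (q := p ν) (hr ν) (x ν) i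
  rw [negMultinomialMass_eq_prod_blockMass, negMultinomialMass_eq_prod_blockMass,
    ← Finset.mul_prod_erase _ _ (Finset.mem_univ ν),
    ← Finset.mul_prod_erase _ (fun μ => blockMass (r μ) (p₀ p μ) (p μ) (x μ)) (Finset.mem_univ ν),
    Finset.prod_congr rfl fun μ hμ => by
      rw [addObs, Function.update_of_ne (Finset.ne_of_mem_erase hμ)],
    addObs, Function.update_self, mul_right_comm, h, hcast]
  ring

/-- Split `obsTotal x ν` into its entries `x ν i`, reindex each part by `addObs ν i`, and use that
the `p ν i` add up to `1 - p₀`. Where the total is `0`, the truncated subtraction and a possible `0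
/ 0` are harmless, since the term is `0`. -/
theorem tsum_negMultinomialMass_shift (hr : ∀ ν, 0 < r ν) (ν : Fin N) {g : (Fin N → ℕ) → ℝ}
    (hg : Summable fun x : Obs m => negMultinomialMass r p x * g (obsTotal x)) :
    Summable (fun x : Obs m => negMultinomialMass r p x *
      ((obsTotal x ν : ℝ) / (r ν + obsTotal x ν - 1) * g (obsTotal x - Pi.single ν 1))) ∧
    ∑' x : Obs m, negMultinomialMass r p x *
      ((obsTotal x ν : ℝ) / (r ν + obsTotal x ν - 1) * g (obsTotal x - Pi.single ν 1)) =
      ∑' x : Obs m, (1 - p₀ p ν) * (negMultinomialMass r p x * g (obsTotal x)) := by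
  set F : Fin (m ν) → Obs m → ℝ := fun i x => negMultinomialMass r p x *
    ((x ν i : ℝ) / (r ν + obsTotal x ν - 1) * g (obsTotal x - Pi.single ν 1)) with hF
  have hshift : ∀ i x, F i (addObs ν i x) = p ν i * (negMultinomialMass r p x * g (obsTotal x)) := by
    intro i x
    have hpos : 0 < r ν + obsTotal x ν := add_pos_of_pos_of_nonneg (hr ν) (Nat.cast_nonneg _)
    have h := negMultinomialMass_addObs hr p ν i x
    have e1 : ((addObs ν i x) ν i : ℝ) = x ν i + 1 := by simp [addObs]
    have e2 : r ν + (obsTotal (addObs ν i x) ν : ℝ) - 1 = r ν + obsTotal x ν := by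
      rw [obsTotal_addObs]
      simp only [Pi.add_apply, Pi.single_eq_same]
      push_cast
      ring
    have e3 : obsTotal (addObs ν i x) - Pi.single ν 1 = obsTotal x := by
      rw [obsTotal_addObs, add_tsub_cancel_right]
    simp only [hF]
    rw [e1, e2, e3, ← mul_assoc, ← mul_div_assoc, h, mul_comm (r ν + _) (p ν i), ← mul_assoc,
      mul_div_assoc, div_self hpos.ne']
    ring
  have hsupp : ∀ i, Function.support (F i) ⊆ range (addObs ν i) := by
    intro i x hx
    have hxi : x ν i ≠ 0 := by
      intro h0
      apply hx
      simp [hF, h0]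
    refine ⟨Function.update x ν (x ν - Pi.single i 1), ?_⟩
    funext μ
    rcases eq_or_ne μ ν with rfl | hne
    · simp only [addObs, Function.update_self]
      funext j
      rcases eq_or_ne j i with rfl | hj
      · simp only [Pi.add_apply, Pi.sub_apply, Pi.single_eq_same]
        omega
      · simp [hj]
    · simp [addObs, hne]
  have hsum : ∀ i, Summable (F i) := by
    intro i
    rw [← (addObs_injective ν i).summable_iff fun x hx => by
      by_contra h
      exact hx (hsupp i h)]
    refine (hg.mul_left (p ν i)).congr fun x => ?_
    rw [Function.comp_apply, hshift]
  have hval : ∀ i, ∑' x, F i x =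
      ∑' x : Obs m, p ν i * (negMultinomialMass r p x * g (obsTotal x)) := by
    intro i
    rw [← (addObs_injective ν i).tsum_eq (hsupp i)]
    exact tsum_congr fun x => hshift i x
  have hFsum : (fun x : Obs m => negMultinomialMass r p x *
      ((obsTotal x ν : ℝ) / (r ν + obsTotal x ν - 1) * g (obsTotal x - Pi.single ν 1))) =
      fun x => ∑ i, F i x := by
    funext x
    simp only [hF]
    rw [← Finset.mul_sum, ← Finset.sum_mul, ← Finset.sum_div, obsTotal]
    push_cast
    rfl
  rw [hFsum]
  refine ⟨summable_sum fun i _ => hsum i, ?_⟩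
  rw [Summable.tsum_finsetSum fun i _ => hsum i, Finset.sum_congr rfl fun i _ => hval i,
    ← Summable.tsum_finsetSum fun i _ => hg.mul_left _]
  refine tsum_congr fun x => ?_
  rw [← Finset.sum_mul, p₀, sub_sub_cancel]

end

end MultinomialPrediction

namespace MultinomialPrediction

section

variable {N L : ℕ} {m : Fin N → ℕ} {d : Fin L → ℕ} {nu : ∀ t : Fin L, Fin (d t) → Fin N}
  {l : Fin L → ℕ} {r a₀ : Fin N → ℝ} {a : ∀ ν : Fin N, Fin (m ν) → ℝ}
  {α β : ℝ} {γ s A : Fin N → ℝ}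

/-! ### The gain of one further draw -/

theorem sum_log_Gamma_add_single {z : Fin N → ℝ} (hz : ∀ ν, 0 < z ν) (ν : Fin N) :
    ∑ μ, Real.log (Real.Gamma ((z + Pi.single ν 1 : Fin N → ℝ) μ)) =
      Real.log (z ν) + ∑ μ, Real.log (Real.Gamma (z μ)) := by
  rw [← Finset.add_sum_erase _ _ (Finset.mem_univ ν),
    ← Finset.add_sum_erase _ (fun μ => Real.log (Real.Gamma (z μ))) (Finset.mem_univ ν),
    Finset.sum_congr rfl fun μ hμ => by
      rw [Pi.add_apply, Pi.single_eq_of_ne (Finset.ne_of_mem_erase hμ), add_zero],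
    Pi.add_apply, Pi.single_eq_same, log_Gamma_add_one (hz ν), add_assoc]

theorem cast_add_single (b : Fin N → ℝ) (c : Fin N → ℕ) (ν : Fin N) :
    (fun μ => b μ + ((c + Pi.single ν 1 : Fin N → ℕ) μ : ℝ)) =
      (fun μ => b μ + (c μ : ℝ)) + Pi.single ν 1 := by
  funext μ
  rcases eq_or_ne μ ν with rfl | h
  · simp [add_assoc]
  · simp [h]

section Gain

variable (hα : 0 < α) (hβ : 0 < β) (hγ : ∀ ν, 0 < γ ν) (hs : ∀ ν, 0 < s ν)
  (hA : ∀ ν, 0 ≤ A ν) {c n : Fin N → ℕ} (hcn : c ≤ n) (ν : Fin N) (y : Fin N → ℕ)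

include hA hcn in
theorem shape_le_rate (μ : Fin N) : s μ + c μ ≤ s μ + A μ + y μ + n μ := by
  have h1 : (c μ : ℝ) ≤ n μ := Nat.cast_le.2 (hcn μ)
  have h2 := hA μ
  have h3 : (0 : ℝ) ≤ y μ := Nat.cast_nonneg _
  linarith

include hA hcn in
theorem shape_le_rate_add_single (μ : Fin N) :
    s μ + c μ ≤ ((fun μ => s μ + A μ + y μ + n μ) + Pi.single ν 1 : Fin N → ℝ) μ :=
  (shape_le_rate hA hcn y μ).trans (le_add_single (fun μ => s μ + A μ + y μ + n μ) ν μ)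

include hα hβ hγ hs hA hcn

/-- This difference and the next are expressed through the same moments, those with the larger rate
`τ + e`, so that they can be compared directly. -/
theorem logTiltRatio_sub_right :
    logTiltRatio α β γ s A c n y - logTiltRatio α β γ s A c (n + Pi.single ν 1) y =
      Real.log (((s ν + A ν + y ν + n ν) *
          tiltMoment α β γ (fun μ => s μ + c μ)
            ((fun μ => s μ + A μ + y μ + n μ) + Pi.single ν 1) 0 +
        γ ν * tiltMoment α β γ (fun μ => s μ + c μ)
            ((fun μ => s μ + A μ + y μ + n μ) + Pi.single ν 1) 1) /
        ((s ν + A ν + y ν + n ν) * tiltMoment α β γ (fun μ => s μ + c μ)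
            ((fun μ => s μ + A μ + y μ + n μ) + Pi.single ν 1) 0)) := by
  have hσ : ∀ μ, 0 < s μ + c μ := fun μ => add_pos_of_pos_of_nonneg (hs μ) (Nat.cast_nonneg _)
  have hστ := shape_le_rate (s := s) hA hcn y
  have hτ : ∀ μ, 0 < s μ + A μ + y μ + n μ := fun μ => (hσ μ).trans_le (hστ μ)
  have hστ' := shape_le_rate_add_single (s := s) hA hcn ν y
  have m0 := tiltMoment_pos hα hβ hγ hσ hστ' 0
  have m1 := tiltMoment_pos hα hβ hγ hσ hστ' 1
  have hg := hγ ν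
  have hM := hτ ν
  have e := tiltMoment_eq_add_single_right hα hβ hγ hσ hστ ν 0
  have hS := sum_log_Gamma_add_single hτ ν
  rw [Real.log_div (by positivity) (by positivity), Real.log_mul hM.ne' m0.ne']
  unfold logTiltRatio
  rw [e]
  simp only [congrFun (cast_add_single (fun μ => s μ + A μ + y μ) n ν),
    Finset.sum_sub_distrib, hS, zero_add]
  ring

theorem logTiltRatio_sub_left :
    logTiltRatio α β γ s A (c + Pi.single ν 1) (n + Pi.single ν 1) y -
        logTiltRatio α β γ s A c (n + Pi.single ν 1) y =
      Real.log (((s ν + c ν) *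
          tiltMoment α β γ (fun μ => s μ + c μ)
            ((fun μ => s μ + A μ + y μ + n μ) + Pi.single ν 1) 0 +
        γ ν * tiltMoment α β γ (fun μ => s μ + c μ)
            ((fun μ => s μ + A μ + y μ + n μ) + Pi.single ν 1) 1) /
        ((s ν + c ν) * tiltMoment α β γ (fun μ => s μ + c μ)
            ((fun μ => s μ + A μ + y μ + n μ) + Pi.single ν 1) 0)) := by
  have hσ : ∀ μ, 0 < s μ + c μ := fun μ => add_pos_of_pos_of_nonneg (hs μ) (Nat.cast_nonneg _)
  have hστ := shape_le_rate (s := s) hA hcn y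
  have hστ' := shape_le_rate_add_single (s := s) hA hcn ν y
  have m0 := tiltMoment_pos hα hβ hγ hσ hστ' 0
  have m1 := tiltMoment_pos hα hβ hγ hσ hστ' 1
  have hg := hγ ν
  have hM := hσ ν
  have e := tiltMoment_add_single_left hα hβ hγ hσ hστ' ν 0
  have hS := sum_log_Gamma_add_single hσ ν
  rw [Real.log_div (by positivity) (by positivity), Real.log_mul hM.ne' m0.ne']
  unfold logTiltRatio
  simp only [congrFun (cast_add_single (fun μ => s μ + A μ + y μ) n ν),
    congrFun (cast_add_single s c ν), Finset.sum_sub_distrib, hS]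
  rw [e, zero_add]
  ring

/-- With `k0`, `k1` the common moments, this compares `1 + γ k1 / (τ k0)` with `1 + γ k1 / (σ k0)`,
where `σ < τ` because `A ν > 0`. It settles observations with no count in block `ν` and is the
source of strictness. -/
theorem logTiltRatio_gain_pos (hAν : 0 < A ν) :
    logTiltRatio α β γ s A c n y - logTiltRatio α β γ s A c (n + Pi.single ν 1) y <
      logTiltRatio α β γ s A (c + Pi.single ν 1) (n + Pi.single ν 1) y -
        logTiltRatio α β γ s A c (n + Pi.single ν 1) y := by
  rw [logTiltRatio_sub_right hα hβ hγ hs hA hcn, logTiltRatio_sub_left hα hβ hγ hs hA hcn]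
  have hσ : ∀ μ, 0 < s μ + c μ := fun μ => add_pos_of_pos_of_nonneg (hs μ) (Nat.cast_nonneg _)
  have hστ := shape_le_rate (s := s) hA hcn y
  have hστ' := shape_le_rate_add_single (s := s) hA hcn ν y
  have m0 := tiltMoment_pos hα hβ hγ hσ hστ' 0
  have m1 := tiltMoment_pos hα hβ hγ hσ hστ' 1
  have hg := hγ ν
  have hσν := hσ ν
  have hM : 0 < s ν + A ν + y ν + n ν := hσν.trans_le (hστ ν)
  have hlt : s ν + c ν < s ν + A ν + y ν + n ν := by
    have h1 : (c ν : ℝ) ≤ n ν := Nat.cast_le.2 (hcn ν)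
    have h3 : (0 : ℝ) ≤ y ν := Nat.cast_nonneg _
    linarith
  refine Real.log_lt_log (by positivity) ?_
  rw [div_lt_div_iff₀ (by positivity) (by positivity)]
  have := mul_lt_mul_of_pos_right hlt (mul_pos (mul_pos hg m1) m0)
  linarith

theorem logTiltRatio_gain_nonneg {t : ℝ} (ht : 0 ≤ t) (ht1 : t ≤ 1)
    (hK : (α + 1) * γ ν / (β + γ ν) +
      t * (s ν + A ν + (y + Pi.single ν 1 : Fin N → ℕ) ν + n ν) ≤
      (s ν + A ν + (y + Pi.single ν 1 : Fin N → ℕ) ν + n ν) - (s ν + c ν)) :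
    logTiltRatio α β γ s A c n (y + Pi.single ν 1) -
        logTiltRatio α β γ s A c (n + Pi.single ν 1) (y + Pi.single ν 1) +
      t * (logTiltRatio α β γ s A (c + Pi.single ν 1) (n + Pi.single ν 1) y -
        logTiltRatio α β γ s A c (n + Pi.single ν 1) y) ≤
      logTiltRatio α β γ s A (c + Pi.single ν 1) (n + Pi.single ν 1) (y + Pi.single ν 1) -
        logTiltRatio α β γ s A c (n + Pi.single ν 1) (y + Pi.single ν 1) := by
  rw [logTiltRatio_sub_right hα hβ hγ hs hA hcn, logTiltRatio_sub_left hα hβ hγ hs hA hcn,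
    logTiltRatio_sub_left hα hβ hγ hs hA hcn]
  -- One more observation shifts the rate as one more draw does. So the gain at `y` lives at rate
  -- `τ`, that at `y + e` at rate `τ + e`.
  have hrate : (fun μ => s μ + A μ + y μ + n μ) + Pi.single ν 1 =
      fun μ => s μ + A μ + (y + Pi.single ν 1 : Fin N → ℕ) μ + n μ := by
    rw [← cast_add_single]
    funext μ
    simp only [Pi.add_apply]
    push_cast
    ring
  rw [hrate]
  set σ : Fin N → ℝ := fun μ => s μ + c μ with hσdef
  set τ : Fin N → ℝ := fun μ => s μ + A μ + (y + Pi.single ν 1 : Fin N → ℕ) μ + n μ with hτdef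
  have hσ : ∀ μ, 0 < σ μ := fun μ => add_pos_of_pos_of_nonneg (hs μ) (Nat.cast_nonneg _)
  have hστ : ∀ μ, σ μ ≤ τ μ := shape_le_rate (s := s) hA hcn _
  have hστ' : ∀ μ, σ μ ≤ (τ + Pi.single ν 1 : Fin N → ℝ) μ := fun μ =>
    (hστ μ).trans (le_add_single _ ν μ)
  have m0 := tiltMoment_pos hα hβ hγ hσ hστ' 0
  have m1 := tiltMoment_pos hα hβ hγ hσ hστ' 1
  have m2 := tiltMoment_pos hα hβ hγ hσ hστ' 2
  have hratio := tiltMoment_ratio_le hα hβ hγ hσ hστ' (M := τ ν) (t := t) (j := ν)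
    (by simp) (hστ ν) ht1 hK
  rw [tiltMoment_eq_add_single_right hα hβ hγ hσ hστ ν 0,
    tiltMoment_eq_add_single_right hα hβ hγ hσ hστ ν 1]
  have hg := hγ ν
  have hσν := hσ ν
  have hM : 0 < τ ν := hσν.trans_le (hστ ν)
  change Real.log ((τ ν * _ + _) / (τ ν * _)) + t * Real.log ((σ ν * _ + _) / (σ ν * _)) ≤
    Real.log ((σ ν * _ + _) / (σ ν * _))
  simp only [zero_add, Nat.reduceAdd]
  set k0 := tiltMoment α β γ σ (τ + Pi.single ν 1) 0
  set k1 := tiltMoment α β γ σ (τ + Pi.single ν 1) 1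
  set k2 := tiltMoment α β γ σ (τ + Pi.single ν 1) 2
  set z := γ ν * (τ ν * k1 + γ ν * k2) / (σ ν * (τ ν * k0 + γ ν * k1)) with hz
  have hz0 : 0 ≤ z := by positivity
  have e1 : (σ ν * (τ ν * k0 + γ ν * k1) + γ ν * (τ ν * k1 + γ ν * k2)) /
      (σ ν * (τ ν * k0 + γ ν * k1)) = 1 + z := by
    rw [hz]
    field_simp
  -- Bernoulli's inequality; this is where `0 ≤ t ≤ 1` is needed.
  have hlog : t * Real.log (1 + z) ≤ Real.log (1 + t * z) := by
    rw [← Real.log_rpow (by linarith)]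
    exact Real.log_le_log (by positivity)
      (rpow_one_add_le_one_add_mul_self (by linarith) ht ht1)
  rw [e1]
  refine (add_le_add_right hlog _).trans ?_
  have htz : 0 < 1 + t * z := by positivity
  rw [← Real.log_mul (by positivity) htz.ne']
  refine Real.log_le_log (by positivity) ?_
  have e2 : (τ ν * k0 + γ ν * k1) / (τ ν * k0) * (1 + t * z) =
      (σ ν * (τ ν * k0 + γ ν * k1) + t * (γ ν * (τ ν * k1 + γ ν * k2))) / (σ ν * τ ν * k0) := by
    rw [hz]
    field_simp
  rw [e2, div_le_div_iff₀ (by positivity) (by positivity)]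
  -- After clearing denominators the claim is exactly this multiple of `hratio`.
  have h := mul_le_mul_of_nonneg_left hratio (by positivity : 0 ≤ γ ν * (σ ν * k0))
  linarith

end Gain

/-! ### Expected gain and domination -/

/-- Multiplying by `ρ + x - 1` and subtracting `h` leaves `(ρ - 1)(n - c) + x (T - 1 - c) ≥ 0`. The
second term is nonnegative because the draw under consideration is at most the `T`-th, so `c ≤ n ≤ T
- 1`. -/
theorem gain_condition {K ρ b A x T c n : ℝ} (hρ : 1 ≤ ρ) (hx : 1 ≤ x) (hcn : c ≤ n)
    (hnT : n + 1 ≤ T) (h : (K - A) * (ρ - 1) ≤ x * (-K - T - b)) :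
    K + x / (ρ + x - 1) * (ρ + b + A + x + n) ≤ (ρ + b + A + x + n) - (ρ + b + c) := by
  have hpos : 0 < ρ + x - 1 := by linarith
  have e : K + x / (ρ + x - 1) * (ρ + b + A + x + n) =
      (K * (ρ + x - 1) + x * (ρ + b + A + x + n)) / (ρ + x - 1) := by
    field_simp
  rw [e, div_le_iff₀ hpos]
  have h1 := mul_nonneg (by linarith : 0 ≤ ρ - 1) (by linarith : 0 ≤ n - c)
  have h2 := mul_nonneg (by linarith : 0 ≤ x) (by linarith : 0 ≤ T - 1 - c)
  linarith

/-- The expected change of the log ratio of the predictive masses after `n` further draws among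
which `c` fell into category `0`. -/
noncomputable def expectedGain (m : Fin N → ℕ) (r : Fin N → ℝ) (p : Param m) (α β : ℝ)
    (γ s A : Fin N → ℝ) (c n : Fin N → ℕ) : ℝ :=
  ∑' x : Obs m, negMultinomialMass r p x *
    (logTiltRatio α β γ s A c n (obsTotal x) - logTiltRatio α β γ s A 0 0 (obsTotal x))

theorem summable_logTiltRatio (hα : 0 < α) (hβ : 0 < β) (hγ : ∀ ν, 0 < γ ν) (hs : ∀ ν, 0 < s ν)
    (hA : ∀ ν, 0 ≤ A ν) (hr : ∀ ν, 0 < r ν) {p : Param m} (hp : p ∈ paramSpace m)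
    {c n : Fin N → ℕ} (hcn : c ≤ n) :
    Summable fun x : Obs m =>
      negMultinomialMass r p x * logTiltRatio α β γ s A c n (obsTotal x) :=
  summable_negMultinomialMass_mul hr hp
    (isBigO_obsTotal (isBigO_logTiltRatio hα hβ hγ hs hA hcn))

theorem expectedGain_lt (hα : 0 < α) (hβ : 0 < β) (hγ : ∀ ν, 0 < γ ν)
    (hr : ∀ ν, 1 ≤ r ν) (hra : ∀ ν, 0 < r ν + a₀ ν) (hA : ∀ ν, 0 < A ν) {T : Fin N → ℕ}
    (hassump : ∀ ν, ∀ x : ℕ, 1 ≤ x →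
      ((α + 1) * γ ν / (β + γ ν) - A ν) * (r ν - 1) ≤
        (x : ℝ) * (-((α + 1) * γ ν / (β + γ ν)) - (T ν : ℝ) - a₀ ν))
    {p : Param m} (hp : p ∈ paramSpace m) {c n : Fin N → ℕ} {ν : Fin N} (hcn : c ≤ n)
    (hnT : n ν < T ν) :
    expectedGain m r p α β γ (fun ν => r ν + a₀ ν) A c n <
      p₀ p ν * expectedGain m r p α β γ (fun ν => r ν + a₀ ν) A (c + Pi.single ν 1)
        (n + Pi.single ν 1) +
      (1 - p₀ p ν) * expectedGain m r p α β γ (fun ν => r ν + a₀ ν) A c (n + Pi.single ν 1) := by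
  have hr0 : ∀ ν, 0 < r ν := fun ν => one_pos.trans_le (hr ν)
  have hA0 : ∀ ν, 0 ≤ A ν := fun ν => (hA ν).le
  have hcn1 : c ≤ n + Pi.single ν 1 := hcn.trans le_self_add
  have hcn2 : c + Pi.single ν 1 ≤ n + Pi.single ν 1 := add_le_add_left hcn _
  set ℓ : (Fin N → ℕ) → (Fin N → ℕ) → (Fin N → ℕ) → ℝ :=
    logTiltRatio α β γ (fun ν => r ν + a₀ ν) A with hℓ
  have hsum : ∀ {c n : Fin N → ℕ}, c ≤ n → Summable fun x : Obs m =>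
      negMultinomialMass r p x * ℓ c n (obsTotal x) := fun h =>
    summable_logTiltRatio hα hβ hγ hra hA0 hr0 hp h
  have hV : ∀ {c n : Fin N → ℕ}, c ≤ n →
      expectedGain m r p α β γ (fun ν => r ν + a₀ ν) A c n =
        ∑' x : Obs m, negMultinomialMass r p x * ℓ c n (obsTotal x) -
        ∑' x : Obs m, negMultinomialMass r p x * ℓ 0 0 (obsTotal x) := by
    intro c n h
    rw [expectedGain, ← (hsum h).tsum_sub (hsum le_rfl)]
    exact tsum_congr fun x => mul_sub _ _ _
  rw [hV hcn, hV hcn1, hV hcn2]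
  set g : (Fin N → ℕ) → ℝ := fun y =>
    ℓ (c + Pi.single ν 1) (n + Pi.single ν 1) y - ℓ c (n + Pi.single ν 1) y with hg
  set h : (Fin N → ℕ) → ℝ := fun y => ℓ c n y - ℓ c (n + Pi.single ν 1) y with hh
  have sg : Summable fun x : Obs m => negMultinomialMass r p x * g (obsTotal x) :=
    ((hsum hcn2).sub (hsum hcn1)).congr fun x => (mul_sub _ _ _).symm
  have sh : Summable fun x : Obs m => negMultinomialMass r p x * h (obsTotal x) :=
    ((hsum hcn).sub (hsum hcn1)).congr fun x => (mul_sub _ _ _).symm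
  have eg : ∑' x : Obs m, negMultinomialMass r p x * g (obsTotal x) =
      ∑' x : Obs m, negMultinomialMass r p x *
        ℓ (c + Pi.single ν 1) (n + Pi.single ν 1) (obsTotal x) -
      ∑' x : Obs m, negMultinomialMass r p x * ℓ c (n + Pi.single ν 1) (obsTotal x) := by
    rw [← (hsum hcn2).tsum_sub (hsum hcn1)]
    exact tsum_congr fun x => mul_sub _ _ _
  have eh : ∑' x : Obs m, negMultinomialMass r p x * h (obsTotal x) =
      ∑' x : Obs m, negMultinomialMass r p x * ℓ c n (obsTotal x) -
      ∑' x : Obs m, negMultinomialMass r p x * ℓ c (n + Pi.single ν 1) (obsTotal x) := by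
    rw [← (hsum hcn).tsum_sub (hsum hcn1)]
    exact tsum_congr fun x => mul_sub _ _ _
  obtain ⟨st, et⟩ := tsum_negMultinomialMass_shift hr0 ν sg
  rw [tsum_mul_left] at et
  set q : Obs m → ℝ := fun x =>
    (obsTotal x ν : ℝ) / (r ν + obsTotal x ν - 1) * g (obsTotal x - Pi.single ν 1) with hq
  -- The claim is `E h < p₀ E g`. Since `E q = (1 - p₀) E g` by the shift identity, it follows by
  -- averaging a pointwise inequality free of `p`.
  have hpt : ∀ x : Obs m, h (obsTotal x) + q x ≤ g (obsTotal x) ∧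
      (obsTotal x ν = 0 → h (obsTotal x) + q x < g (obsTotal x)) := by
    intro x
    rcases Nat.eq_zero_or_pos (obsTotal x ν) with h0 | h0
    · have hq0 : q x = 0 := by simp [hq, h0]
      have := logTiltRatio_gain_pos hα hβ hγ hra hA0 hcn ν (obsTotal x) (hA ν)
      rw [hq0, add_zero]
      exact ⟨this.le, fun _ => this⟩
    · refine ⟨?_, fun h => absurd h h0.ne'⟩
      have hx1 : (1 : ℝ) ≤ obsTotal x ν := by exact_mod_cast h0
      have hrν := hr ν
      obtain ⟨y, hy⟩ : ∃ y : Fin N → ℕ, obsTotal x = y + Pi.single ν 1 := by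
        refine ⟨obsTotal x - Pi.single ν 1, ?_⟩
        funext μ
        rcases eq_or_ne μ ν with rfl | hμ
        · simp only [Pi.add_apply, Pi.sub_apply, Pi.single_eq_same]
          omega
        · simp [hμ]
      have hcond := gain_condition hrν hx1 (Nat.cast_le.2 (hcn ν))
        (by exact_mod_cast hnT) (hassump ν _ h0)
      have := logTiltRatio_gain_nonneg hα hβ hγ hra hA0 hcn ν y
        (t := (obsTotal x ν : ℝ) / (r ν + obsTotal x ν - 1))
        (div_nonneg (by linarith) (by linarith))
        ((div_le_one (by linarith)).2 (by linarith)) (by rw [← hy]; exact hcond)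
      simp only [hq, hg, hh]
      rw [hy, add_tsub_cancel_right, ← hy]
      rwa [← hy] at this
  have hlt : ∑' x : Obs m, (negMultinomialMass r p x * h (obsTotal x) +
      negMultinomialMass r p x * q x) < ∑' x : Obs m, negMultinomialMass r p x * g (obsTotal x) := by
    -- The zero observation has positive mass and satisfies the strict inequality.
    refine Summable.tsum_lt_tsum (i := (fun _ _ => 0 : Obs m)) (fun x => ?_) ?_ (sh.add st) sg
    · rw [← mul_add]
      exact mul_le_mul_of_nonneg_left (hpt x).1 (negMultinomialMass_pos hr0 hp x).le
    · rw [← mul_add]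
      exact mul_lt_mul_of_pos_left ((hpt _).2 (by simp [obsTotal]))
        (negMultinomialMass_pos hr0 hp _)
  rw [sh.tsum_add st, et] at hlt
  rw [eg, eh] at hlt
  linarith

/-! ### Finiteness of the risks. -/

theorem summable_prod_fintype {X W : Type*} [Fintype W] {f : X × W → ℝ}
    (hf : ∀ w, Summable fun x => f (x, w)) : Summable f := by
  rw [← summable_abs_iff, summable_prod_of_nonneg fun _ => abs_nonneg _]
  refine ⟨fun x => (hasSum_fintype _).summable, ?_⟩
  simp only [tsum_fintype]
  exact summable_sum fun w _ => (hf w).abs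

theorem riskFinite_of_isBigO (hr : ∀ ν, 0 < r ν) {p : Param m} (hp : p ∈ paramSpace m)
    {fhat : Tables m nu l → Obs m → ℝ} (hpos : ∀ w x, 0 < fhat w x)
    (hlog : ∀ w, (fun x => Real.log (fhat w x)) =O[⊤] fun x => 1 + ∑ ν, (obsTotal x ν : ℝ)) :
    RiskFinite r fhat p := by
  refine summable_prod_fintype fun w => ?_
  have h1 : (fun x => tableMass p w * (Real.log (tableMass p w) - Real.log (fhat w x))) =O[⊤]
      fun x => 1 + ∑ ν, (obsTotal x ν : ℝ) :=
    ((isBigO_obsTotal (isBigO_const_total _)).sub (hlog w)).const_mul_left _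
  refine (summable_negMultinomialMass_mul hr hp h1).congr fun x => ?_
  rw [riskTerm, Real.log_div (tableMass_pos hp w).ne' (hpos w x).ne', mul_assoc]

theorem paramSpace_nonempty (m : Fin N → ℕ) : (paramSpace m).Nonempty := by
  refine ⟨fun ν _ => 1 / (m ν + 1), fun ν => ⟨fun _ => by positivity, ?_⟩⟩
  simp only [Finset.sum_const, Finset.card_univ, Fintype.card_fin, nsmul_eq_mul]
  rw [mul_one_div, div_lt_one (by positivity)]
  linarith

end

end MultinomialPrediction

/-! ### Comparison of the risks. -/

open MultinomialPrediction in
theorem mainTheorem4 {N L : ℕ} (hL : 0 < L)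
    (m : Fin N → ℕ) (hm : ∀ ν, 0 < m ν)
    (d : Fin L → ℕ) (hd : ∀ t, 0 < d t)
    (nu : ∀ t : Fin L, Fin (d t) → Fin N) (hnu : ∀ t, StrictMono (nu t))
    (l : Fin L → ℕ) (hl : ∀ t, 0 < l t)
    (r : Fin N → ℝ) (hr : ∀ ν, 1 ≤ r ν)
    (a₀ : Fin N → ℝ) (a : ∀ ν : Fin N, Fin (m ν) → ℝ) (ha : ∀ ν i, 0 < a ν i)
    (hra : ∀ ν, 0 < r ν + a₀ ν)
    (α β : ℝ) (hα : 0 < α) (hβ : 0 < β)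
    (γ : Fin N → ℝ) (hγ : ∀ ν, 0 < γ ν)
    (hassump : ∀ ν, ∀ x : ℕ, 1 ≤ x →
      ((α + 1) * γ ν / (β + γ ν) - ∑ i, a ν i) * (r ν - 1) ≤
        (x : ℝ) * (-((α + 1) * γ ν / (β + γ ν)) -
          (MultinomialPrediction.totalCount nu l ν : ℝ) - a₀ ν)) :
    MultinomialPrediction.Dominates (m := m) (nu := nu) (l := l) r
      (MultinomialPrediction.bayesPredictive r
        (MultinomialPrediction.shrinkagePrior α β γ a₀ a))
      (MultinomialPrediction.bayesPredictive r
        (MultinomialPrediction.dirichletPrior a₀ a)) := by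
  have hr0 : ∀ ν, 0 < r ν := fun ν => one_pos.trans_le (hr ν)
  have hA : ∀ ν, 0 < ∑ i, a ν i := fun ν => by
    have : Nonempty (Fin (m ν)) := ⟨⟨0, hm ν⟩⟩
    exact Finset.sum_pos (fun i _ => ha ν i) Finset.univ_nonempty
  have hA0 : ∀ ν, 0 ≤ ∑ i, a ν i := fun ν => (hA ν).le
  have hcT : ∀ w : Tables m nu l, (fun ν => categoryCount w ν 0) ≤ totalCount nu l := fun w ν =>
    (Nat.le_add_right _ _).trans_eq (sum_categoryCount hnu w ν)
  have hdir := fun (w : Tables m nu l) x =>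
    log_bayesPredictive_dirichletPrior hnu hr0 ha hra w x
  have hshr := fun (w : Tables m nu l) x =>
    log_bayesPredictive_shrinkagePrior hα hβ hγ hnu hr0 ha hra w x
  have hbig := fun w : Tables m nu l =>
    isBigO_log_bayesPredictive_dirichletPrior hnu hr0 ha hra w
  have hfin : ∀ p ∈ paramSpace m,
      RiskFinite (nu := nu) (l := l) r (bayesPredictive r (shrinkagePrior α β γ a₀ a)) p ∧
      RiskFinite (nu := nu) (l := l) r (bayesPredictive r (dirichletPrior a₀ a)) p := by
    intro p hp
    refine ⟨riskFinite_of_isBigO hr0 hp (fun w x => (hshr w x).1) fun w => ?_,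
      riskFinite_of_isBigO hr0 hp (fun w x => (hdir w x).1) hbig⟩
    simp only [fun x => (hshr w x).2]
    exact (hbig w).add (isBigO_obsTotal ((isBigO_logTiltRatio hα hβ hγ hra hA0 (hcT w)).sub
      (isBigO_logTiltRatio hα hβ hγ hra hA0 le_rfl)))
  -- At least one draw has to be predicted; otherwise the risks could not differ.
  have hT : totalCount nu l ≠ 0 := by
    intro h0
    have h1 := congrFun h0 (nu ⟨0, hL⟩ ⟨0, hd _⟩)
    rw [totalCount, Pi.zero_apply, Finset.sum_eq_zero_iff] at h1
    exact (hl ⟨0, hL⟩).ne' (h1 _ (Finset.mem_filter.2 ⟨Finset.mem_univ _, _, rfl⟩))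
  have hlt : ∀ p ∈ paramSpace m,
      risk (nu := nu) (l := l) r (bayesPredictive r (shrinkagePrior α β γ a₀ a)) p <
      risk (nu := nu) (l := l) r (bayesPredictive r (dirichletPrior a₀ a)) p := by
    intro p hp
    obtain ⟨hsh, hdi⟩ := hfin p hp
    rw [← sub_pos, risk, risk, ← Summable.tsum_sub hdi hsh]
    have hterm : ∀ z : Obs m × Tables m nu l,
        riskTerm r (bayesPredictive r (dirichletPrior a₀ a)) p z -
          riskTerm r (bayesPredictive r (shrinkagePrior α β γ a₀ a)) p z =
        tableMass p z.2 * (negMultinomialMass r p z.1 *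
          (logTiltRatio α β γ (fun ν => r ν + a₀ ν) (fun ν => ∑ i, a ν i)
            (fun ν => categoryCount z.2 ν 0) (totalCount nu l) (obsTotal z.1) -
          logTiltRatio α β γ (fun ν => r ν + a₀ ν) (fun ν => ∑ i, a ν i) 0 0
            (obsTotal z.1))) := by
      rintro ⟨x, w⟩
      have ht := (tableMass_pos hp w).ne'
      simp only [riskTerm]
      rw [Real.log_div ht (hdir w x).1.ne', Real.log_div ht (hshr w x).1.ne', (hshr w x).2]
      ring
    have hsw : ∀ w : Tables m nu l, Summable fun x : Obs m => tableMass p w *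
        (negMultinomialMass r p x *
          (logTiltRatio α β γ (fun ν => r ν + a₀ ν) (fun ν => ∑ i, a ν i)
            (fun ν => categoryCount w ν 0) (totalCount nu l) (obsTotal x) -
          logTiltRatio α β γ (fun ν => r ν + a₀ ν) (fun ν => ∑ i, a ν i) 0 0
            (obsTotal x))) := fun w =>
      (((summable_logTiltRatio hα hβ hγ hra hA0 hr0 hp (hcT w)).sub
        (summable_logTiltRatio hα hβ hγ hra hA0 hr0 hp le_rfl)).congr
          fun x => (mul_sub _ _ _).symm).mul_left _
    rw [tsum_congr hterm, (summable_prod_fintype hsw).tsum_prod]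
    simp only [tsum_fintype]
    rw [Summable.tsum_finsetSum fun w _ => hsw w]
    simp only [tsum_mul_left]
    -- Taken at `n = T`: the mean over `W` is the functional at the full generating polynomial, and
    -- the starting value `expectedGain … 0 0` is zero.
    have hmain := lt_monomialFunctional_prod_drawPoly hp (T := totalCount nu l)
      (V := expectedGain m r p α β γ (fun ν => r ν + a₀ ν) (fun ν => ∑ i, a ν i))
      (fun c n ν hcn hn => expectedGain_lt hα hβ hγ hr hra hA hassump hp hcn hn) le_rfl hT
    have h00 : expectedGain m r p α β γ (fun ν => r ν + a₀ ν) (fun ν => ∑ i, a ν i) 0 0 = 0 := by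
      simp [expectedGain]
    rw [h00, ← sum_tableMass_mul_prod_X hnu, map_sum] at hmain
    simp only [monomialFunctional_C_mul_prod_X] at hmain
    exact hmain
  refine ⟨hfin, fun p hp => (hlt p hp).le, ?_⟩
  obtain ⟨p, hp⟩ := paramSpace_nonempty m
  exact ⟨p, hp, hlt p hp⟩
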